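/- Let $(Q,L_d)$ be a discrete mechanical system: $Q$ is a finite-dimensional smooth manifold and $L_d:Q\times Q\to\mathbb R$ is smooth. Let $G$ be a Lie group acting on $Q$ on the left, smoothly, freely and properly. Fix $\mu\in\mathfrak g^*$, let $G_\mu=\{g\in G:\mathrm{Ad}^*_{g^{-1}}\mu=\mu\}$, $\mathfrak g_\mu=\mathrm{Lie}(G_\mu)$, and let $\pi_\mu:Q\to Q/G_\mu$ be the quotient map onto the quotient manifold. Assume $L_d$ is invariant under the diagonal action of $G_\mu$, and let $J_\mu:Q\times Q\to\mathfrak g_\mu^*$, $J_\mu(q_0,q_1)\xi=-D_1L_d(q_0,q_1)\,\xi_Q(q_0)$, where $\xi_Q$ is the infinitesimal generator of $\xi$. We write $J_\mu(q_0,q_1)=\mu$ for $J_\mu(q_0,q_1)=\mu|_{\mathfrak g_\mu}$. Assume that $G_\mu$ is a group of $\mu$-good symmetries of $(Q,L_d)$, i.e. (a) $L_d$ is regular: for all $q_1$ the map $Q\to T^*_{q_1}Q$, $q_0\mapsto D_2L_d(q_0,q_1)$, and for all $q_0$ the map $Q\to T^*_{q_0}Q$, $q_1\mapsto -D_1L_d(q_0,q_1)$,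 are local diffeomorphisms; (b) $L_d$ is $G_\mu$-regular: for all $(q_0,q_1)$ the restriction of $D_2D_1L_d(q_0,q_1)$ to $T_{q_0}(G_\mu q_0)\times T_{q_1}(G_\mu q_1)$ is nondegenerate; (c) for every $q\in Q$ there is a unique $g\in G_\mu$ with $J_\mu(q,gq)=\mu$; this $g$ is denoted $\gamma(q)$; (d) if $J_\mu(q_0,q_1)=\mu=J_\mu(q_0,gq_1)$ with $q_0,q_1\in Q$ and $g\in G_\mu$, then $g=e$. Put $\mathcal J_\mu=J_\mu^{-1}(\{\mu\})$ and let $\mathfrak U=\{(q_0,hq_1):(q_0,q_1)\in\mathcal J_\mu,\ h\in G_\mu\}$ be its domain. Then: 1. For every $(q_0,q_1)\in Q\times Q$ there is at most one $g\in G_\mu$ with $J_\mu(q_0,g^{-1}q_1)=\mu$. The set $\mathfrak U$ is open, invariant under $(q_0,q_1)\mapsto(g_0q_0,g_1q_1)$ for all $g_0,g_1\in G_\mu$, and contains all pairs $(q,gq)$ with $q\in Q$, $g\in G_\mu$; and for every $(q_0,q_1)\in\mathfrak U$ there is a unique $g\in G_\mu$ with $J_\mu(q_0,g^{-1}q_1)=\mu$.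 In particular, if the domain is the whole space, $\mathfrak U=Q\times Q$, then for every $(q_0,q_1)\in Q\times Q$ there is a unique such $g$. 2. $\mathcal J_\mu$ is an affine discrete connection on $\pi_\mu$ with level $\gamma$. That is, $\gamma:Q\to G_\mu$ is smooth and $\gamma(hq)=h\gamma(q)h^{-1}$ for $h\in G_\mu$; $\mathcal J_\mu$ is an embedded submanifold of $Q\times Q$ that is invariant under the diagonal $G_\mu$-action and contains $\{(q,\gamma(q)q):q\in Q\}$; and $(\mathrm{id}_Q\times\pi_\mu)|_{\mathcal J_\mu}:\mathcal J_\mu\to Q\times(Q/G_\mu)$ is an injective local diffeomorphism. -/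

import Mathlib

open scoped Manifold ContDiff Topology

noncomputable section

namespace DiscreteMechanics

section LieGroup

variable {EG : Type*} [NormedAddCommGroup EG] [NormedSpace ℝ EG]
  {G : Type*} [TopologicalSpace G] [ChartedSpace EG G] [Group G]

variable (EG) in
/-- The adjoint action of `g` on the Lie algebra `𝔤 = T₁G`: the derivative at `1` of
conjugation by `g`. -/
def Ad (g : G) : GroupLieAlgebra 𝓘(ℝ, EG) G →L[ℝ] GroupLieAlgebra 𝓘(ℝ, EG) G :=
  mfderiv 𝓘(ℝ, EG) 𝓘(ℝ, EG) (fun x : G => g * x * g⁻¹) 1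

theorem mdifferentiable_conj [LieGroup 𝓘(ℝ, EG) ∞ G] (g : G) :
    MDifferentiable 𝓘(ℝ, EG) 𝓘(ℝ, EG) (fun x : G => g * x * g⁻¹) := by
  have h : ContMDiff 𝓘(ℝ, EG) 𝓘(ℝ, EG) ∞ (fun x : G => g * x * g⁻¹) :=
    (contMDiff_const.mul contMDiff_id).mul contMDiff_const
  exact h.mdifferentiable (by simp)

theorem Ad_one : Ad EG (1 : G) = ContinuousLinearMap.id ℝ _ := by
  have h : (fun x : G => (1 : G) * x * (1 : G)⁻¹) = id := by ext x; simp
  unfold Ad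
  rw [h]
  exact mfderiv_id

theorem Ad_mul [LieGroup 𝓘(ℝ, EG) ∞ G] (g h : G) (ξ : GroupLieAlgebra 𝓘(ℝ, EG) G) :
    Ad EG (g * h) ξ = Ad EG g (Ad EG h ξ) := by
  have e : (fun x : G => g * h * x * (g * h)⁻¹) =
      (fun x : G => g * x * g⁻¹) ∘ (fun x : G => h * x * h⁻¹) := by
    ext x; simp [mul_assoc]
  have e1 : h * 1 * h⁻¹ = (1 : G) := by simp
  have e2 : ∀ y : G, y = 1 →
      (mfderiv 𝓘(ℝ, EG) 𝓘(ℝ, EG) (fun x : G => g * x * g⁻¹) y : EG →L[ℝ] EG) =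
        (mfderiv 𝓘(ℝ, EG) 𝓘(ℝ, EG) (fun x : G => g * x * g⁻¹) 1 : EG →L[ℝ] EG) := by
    rintro y rfl
    rfl
  unfold Ad
  rw [e, mfderiv_comp (I' := 𝓘(ℝ, EG)) (1 : G) (mdifferentiable_conj g _)
    (mdifferentiable_conj h _)]
  exact congrArg (fun T : EG →L[ℝ] EG =>
    T (mfderiv 𝓘(ℝ, EG) 𝓘(ℝ, EG) (fun x : G => h * x * h⁻¹) 1 ξ)) (e2 _ e1)

/-- The isotropy subgroup `G_μ = {g : Ad*_{g⁻¹} μ = μ}` of `μ ∈ 𝔤*` under the coadjoint action,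
where `Ad*_{g⁻¹} μ = μ ∘ Ad_{g⁻¹}`. -/
def coadjointIsotropy [LieGroup 𝓘(ℝ, EG) ∞ G] (μ : GroupLieAlgebra 𝓘(ℝ, EG) G →L[ℝ] ℝ) :
    Subgroup G where
  carrier := {g | ∀ ξ, μ (Ad EG g⁻¹ ξ) = μ ξ}
  one_mem' := by
    intro ξ
    rw [inv_one, Ad_one]
    rfl
  mul_mem' := by
    intro a b ha hb ξ
    rw [mul_inv_rev, Ad_mul, hb, ha]
  inv_mem' := by
    intro a ha ξ
    rw [inv_inv, ← ha (Ad EG a ξ), ← Ad_mul, inv_mul_cancel, Ad_one]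
    rfl

variable (EG) in
/-- The velocity at `t = 0` of a curve in `G` with `c 0 = 1`, as an element of `𝔤 = T₁G`. -/
def velocity (c : ℝ → G) : GroupLieAlgebra 𝓘(ℝ, EG) G :=
  (mfderiv 𝓘(ℝ, ℝ) 𝓘(ℝ, EG) c 0 : ℝ →L[ℝ] EG) 1

theorem velocity_mul [LieGroup 𝓘(ℝ, EG) ∞ G] {a b : ℝ → G}
    (ha : MDifferentiable 𝓘(ℝ, ℝ) 𝓘(ℝ, EG) a) (hb : MDifferentiable 𝓘(ℝ, ℝ) 𝓘(ℝ, EG) b)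
    (ha0 : a 0 = 1) (hb0 : b 0 = 1) :
    velocity EG (fun t => a t * b t) = velocity EG a + velocity EG b := by
  have hm : MDifferentiable (𝓘(ℝ, EG).prod 𝓘(ℝ, EG)) 𝓘(ℝ, EG) (fun p : G × G => p.1 * p.2) :=
    (contMDiff_mul 𝓘(ℝ, EG) ∞).mdifferentiable (by simp)
  have hf : MDifferentiable (𝓘(ℝ, ℝ).prod 𝓘(ℝ, ℝ)) 𝓘(ℝ, EG)
      (fun p : ℝ × ℝ => a p.1 * b p.2) :=
    hm.comp ((ha.comp mdifferentiable_fst).prodMk (hb.comp mdifferentiable_snd))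
  have hd : HasMFDerivAt 𝓘(ℝ, ℝ) (𝓘(ℝ, ℝ).prod 𝓘(ℝ, ℝ)) (fun t : ℝ => (id t, id t)) 0
      ((ContinuousLinearMap.id ℝ ℝ).prod (ContinuousLinearMap.id ℝ ℝ)) :=
    (hasMFDerivAt_id (I := 𝓘(ℝ, ℝ)) (0 : ℝ)).prodMk (hasMFDerivAt_id (I := 𝓘(ℝ, ℝ)) (0 : ℝ))
  have hc := (HasMFDerivAt.comp (f := fun t : ℝ => (id t, id t)) (0 : ℝ)
    (hf (0, 0)).hasMFDerivAt hd).mfderiv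
  have h2 := mfderiv_prod_eq_add_apply (v := ((1 : ℝ), (1 : ℝ))) (hf (0, 0))
  have e1 : (fun z => a z * b 0) = a := by ext z; simp [hb0]
  have e2 : (fun z => a 0 * b z) = b := by ext z; simp [ha0]
  dsimp only at h2
  rw [e1, e2] at h2
  exact (congrArg (fun T : ℝ →L[ℝ] EG => T 1) hc).trans h2

theorem velocity_comp_mul {a : ℝ → G} (ha : MDifferentiable 𝓘(ℝ, ℝ) 𝓘(ℝ, EG) a) (r : ℝ) :
    velocity EG (fun t => a (r * t)) = r • velocity EG a := by
  have h1 : HasFDerivAt (fun t : ℝ => r * t) (r • ContinuousLinearMap.id ℝ ℝ) 0 :=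
    (hasFDerivAt_id (𝕜 := ℝ) (0 : ℝ)).const_mul r
  have hc := (HasMFDerivAt.comp (0 : ℝ) (ha (r * 0)).hasMFDerivAt h1.hasMFDerivAt).mfderiv
  have e : ∀ y : ℝ, y = 0 → (mfderiv 𝓘(ℝ, ℝ) 𝓘(ℝ, EG) a y : ℝ →L[ℝ] EG) =
      (mfderiv 𝓘(ℝ, ℝ) 𝓘(ℝ, EG) a 0 : ℝ →L[ℝ] EG) := by
    rintro y rfl
    rfl
  refine (congrArg (fun T : ℝ →L[ℝ] EG => T 1) hc).trans ?_
  refine (congrArg (fun T : ℝ →L[ℝ] EG => T (r • (1 : ℝ))) (e _ (mul_zero r))).trans ?_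
  exact ContinuousLinearMap.map_smul (mfderiv 𝓘(ℝ, ℝ) 𝓘(ℝ, EG) a 0 : ℝ →L[ℝ] EG) r 1

variable (EG) in
/-- The Lie algebra of a (closed) subgroup `H` of `G`, as a subspace of `𝔤 = T₁G`: the velocities
at `t = 0` of the smooth curves in `G` that start at `1` and stay in `H`. -/
def subgroupLieAlgebra [LieGroup 𝓘(ℝ, EG) ∞ G] (H : Subgroup G) :
    Submodule ℝ (GroupLieAlgebra 𝓘(ℝ, EG) G) where
  carrier := {ξ | ∃ c : ℝ → G, ContMDiff 𝓘(ℝ, ℝ) 𝓘(ℝ, EG) ∞ c ∧ c 0 = 1 ∧ (∀ t, c t ∈ H) ∧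
    velocity EG c = ξ}
  zero_mem' := by
    refine ⟨fun _ => 1, contMDiff_const, rfl, fun _ => H.one_mem, ?_⟩
    unfold velocity
    rw [mfderiv_const]
    rfl
  add_mem' := by
    rintro _ _ ⟨a, ha, ha0, haH, rfl⟩ ⟨b, hb, hb0, hbH, rfl⟩
    refine ⟨fun t => a t * b t, ha.mul hb, by simp [ha0, hb0],
      fun t => H.mul_mem (haH t) (hbH t), ?_⟩
    exact velocity_mul (ha.mdifferentiable (by simp)) (hb.mdifferentiable (by simp)) ha0 hb0
  smul_mem' := by
    rintro r _ ⟨a, ha, ha0, haH, rfl⟩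
    have hs : ContMDiff 𝓘(ℝ, ℝ) 𝓘(ℝ, ℝ) ∞ (fun t : ℝ => r * t) :=
      (contDiff_const.mul contDiff_id).contMDiff
    refine ⟨fun t => a (r * t), ha.comp hs, by simp [ha0], fun t => haH _, ?_⟩
    exact velocity_comp_mul (ha.mdifferentiable (by simp)) r

end LieGroup

section Action

variable {EG : Type*} [NormedAddCommGroup EG] [NormedSpace ℝ EG]
  {G : Type*} [TopologicalSpace G] [ChartedSpace EG G] [Group G]
  {E : Type*} [NormedAddCommGroup E] [NormedSpace ℝ E]
  {Q : Type*} [TopologicalSpace Q] [ChartedSpace E Q]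

variable (EG G E) in
/-- `ξ ↦ ξ_Q(q)`, the infinitesimal generator at `q` of the action of `G` on `Q`: the derivative
at `1` of the orbit map `g ↦ g • q`. -/
def infinitesimalGenerator [MulAction G Q] (q : Q) :
    GroupLieAlgebra 𝓘(ℝ, EG) G →L[ℝ] TangentSpace 𝓘(ℝ, E) q :=
  mfderiv 𝓘(ℝ, EG) 𝓘(ℝ, E) (fun g : G => g • q) 1

variable (EG E) in
/-- The vertical space `𝒱^H_q = T_q(H • q)`, i.e. the values at `q` of the infinitesimal
generators of the elements of the Lie algebra of `H`. -/
def verticalSpace [LieGroup 𝓘(ℝ, EG) ∞ G] [MulAction G Q] (H : Subgroup G) (q : Q) :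
    Submodule ℝ (TangentSpace 𝓘(ℝ, E) q) :=
  (subgroupLieAlgebra EG H).map (infinitesimalGenerator EG G E q).toLinearMap

variable (E) in
/-- `D₁L(q₀,q₁) ∈ T*_{q₀}Q`. -/
def D₁ (L : Q × Q → ℝ) (q₀ q₁ : Q) : TangentSpace 𝓘(ℝ, E) q₀ →L[ℝ] ℝ :=
  mfderiv 𝓘(ℝ, E) 𝓘(ℝ, ℝ) (fun x : Q => L (x, q₁)) q₀

variable (E) in
/-- `D₂L(q₀,q₁) ∈ T*_{q₁}Q`. -/
def D₂ (L : Q × Q → ℝ) (q₀ q₁ : Q) : TangentSpace 𝓘(ℝ, E) q₁ →L[ℝ] ℝ :=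
  mfderiv 𝓘(ℝ, E) 𝓘(ℝ, ℝ) (fun y : Q => L (q₀, y)) q₁

variable (E) in
/-- The bilinear form `D₂D₁L(q₀,q₁) : T_{q₀}Q × T_{q₁}Q → ℝ`. -/
def D₂D₁ (L : Q × Q → ℝ) (q₀ q₁ : Q) (v : TangentSpace 𝓘(ℝ, E) q₀)
    (w : TangentSpace 𝓘(ℝ, E) q₁) : ℝ :=
  mfderiv 𝓘(ℝ, E) 𝓘(ℝ, ℝ) (fun y : Q => D₁ E L q₀ y v) q₁ w

variable (E) in
/-- Regularity of the discrete Lagrangian `L`: for all `q₁` the map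
`Q → T*_{q₁}Q, q₀ ↦ D₂L(q₀,q₁)`, and for all `q₀` the map `Q → T*_{q₀}Q, q₁ ↦ -D₁L(q₀,q₁)`, are
local diffeomorphisms.  (A tangent space of `Q` is the model vector space `E`.) -/
structure IsRegular (L : Q × Q → ℝ) : Prop where
  plus : ∀ q₁ : Q, IsLocalDiffeomorph (N := E →L[ℝ] ℝ) 𝓘(ℝ, E) 𝓘(ℝ, E →L[ℝ] ℝ) ∞
    (fun q₀ : Q => D₂ E L q₀ q₁)
  minus : ∀ q₀ : Q, IsLocalDiffeomorph (N := E →L[ℝ] ℝ) 𝓘(ℝ, E) 𝓘(ℝ, E →L[ℝ] ℝ) ∞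
    (fun q₁ : Q => -D₁ E L q₀ q₁)

variable (EG E) in
/-- `L` is `H`-regular: at every `(q₀,q₁)` the restriction of `D₂D₁L(q₀,q₁)` to
`𝒱^H_{q₀} × 𝒱^H_{q₁}` is nondegenerate. -/
def IsSubgroupRegular [LieGroup 𝓘(ℝ, EG) ∞ G] [MulAction G Q] (H : Subgroup G)
    (L : Q × Q → ℝ) : Prop :=
  ∀ q₀ q₁ : Q,
    (∀ v ∈ verticalSpace EG E H q₀,
      (∀ w ∈ verticalSpace EG E H q₁, D₂D₁ E L q₀ q₁ v w = 0) → v = 0) ∧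
    (∀ w ∈ verticalSpace EG E H q₁,
      (∀ v ∈ verticalSpace EG E H q₀, D₂D₁ E L q₀ q₁ v w = 0) → w = 0)

variable (EG E) in
/-- The discrete momentum map `Q × Q → 𝔥*` of the action of the subgroup `H`:
`J(q₀,q₁)ξ = -D₁L(q₀,q₁)(ξ_Q(q₀))` for `ξ ∈ 𝔥 = Lie H`. -/
def momentumMap [LieGroup 𝓘(ℝ, EG) ∞ G] [MulAction G Q] (H : Subgroup G) (L : Q × Q → ℝ)
    (q₀ q₁ : Q) : subgroupLieAlgebra EG H →L[ℝ] ℝ :=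
  (-((D₁ E L q₀ q₁).comp (infinitesimalGenerator EG G E q₀))).comp
    (subgroupLieAlgebra EG H).subtypeL

/-- `μ ∈ 𝔤*` regarded as an element of `𝔤_μ*`, by restriction. -/
def restrictMu [LieGroup 𝓘(ℝ, EG) ∞ G] (μ : GroupLieAlgebra 𝓘(ℝ, EG) G →L[ℝ] ℝ) :
    subgroupLieAlgebra EG (coadjointIsotropy μ) →L[ℝ] ℝ :=
  μ.comp (subgroupLieAlgebra EG (coadjointIsotropy μ)).subtypeL

variable (E) in
/-- The level set `J_μ⁻¹(μ) ⊆ Q × Q` of the discrete momentum map `J_μ` of the `G_μ`-action. -/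
def momentumLevel [LieGroup 𝓘(ℝ, EG) ∞ G] [MulAction G Q]
    (μ : GroupLieAlgebra 𝓘(ℝ, EG) G →L[ℝ] ℝ) (L : Q × Q → ℝ) : Set (Q × Q) :=
  {p | momentumMap EG E (coadjointIsotropy μ) L p.1 p.2 = restrictMu μ}

variable (E) in
/-- `G_μ` is a group of `μ`-good symmetries of the discrete mechanical system `(Q, L)`. -/
structure IsMuGood [LieGroup 𝓘(ℝ, EG) ∞ G] [MulAction G Q]
    (μ : GroupLieAlgebra 𝓘(ℝ, EG) G →L[ℝ] ℝ) (L : Q × Q → ℝ) : Prop where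
  symm : ∀ g ∈ coadjointIsotropy μ, ∀ q₀ q₁ : Q, L (g • q₀, g • q₁) = L (q₀, q₁)
  regular : IsRegular E L
  subgroupRegular : IsSubgroupRegular EG E (coadjointIsotropy μ) L
  existsUnique_vertical : ∀ q : Q, ∃! g : coadjointIsotropy μ,
    momentumMap EG E (coadjointIsotropy μ) L q (g • q) = restrictMu μ
  eq_one : ∀ (q₀ q₁ : Q) (g : coadjointIsotropy μ),
    momentumMap EG E (coadjointIsotropy μ) L q₀ q₁ = restrictMu μ →
    momentumMap EG E (coadjointIsotropy μ) L q₀ (g • q₁) = restrictMu μ → g = 1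

variable (EG E) in
/-- `Hor ⊆ Q × Q` is an affine discrete connection with level `γ : Q → H` on `π : Q → Q/H`.

The subgroup `H` is a closed, hence embedded, subgroup of the Lie group `G`, so that smoothness of
`γ` is smoothness as a map to `G`.  `Hor` is an embedded submanifold if it has a (then unique)
smooth structure, compatible with the subspace topology, for which the inclusion in `Q × Q` is a
smooth embedding. -/
structure IsAffineDiscreteConnection [MulAction G Q] (EB : Type*) [NormedAddCommGroup EB]
    [NormedSpace ℝ EB] (H : Subgroup G) [ChartedSpace EB (MulAction.orbitRel.Quotient H Q)]
    (γ : Q → H) (Hor : Set (Q × Q)) : Prop where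
  level_smooth : ContMDiff 𝓘(ℝ, E) 𝓘(ℝ, EG) ∞ (fun q : Q => (γ q : G))
  level_equivariant : ∀ (h : H) (q : Q), γ (h • q) = h * γ q * h⁻¹
  graph_mem : ∀ q : Q, (q, γ q • q) ∈ Hor
  invariant : ∀ (h : H) (q₀ q₁ : Q), (q₀, q₁) ∈ Hor → (h • q₀, h • q₁) ∈ Hor
  injOn : Set.InjOn
    (fun p : Q × Q => (p.1, (Quotient.mk _ p.2 : MulAction.orbitRel.Quotient H Q))) Hor
  submanifold : ∃ (k : ℕ) (_ : ChartedSpace (EuclideanSpace ℝ (Fin k)) Hor),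
    IsManifold 𝓘(ℝ, EuclideanSpace ℝ (Fin k)) ∞ Hor ∧
    Manifold.IsSmoothEmbedding 𝓘(ℝ, EuclideanSpace ℝ (Fin k)) (𝓘(ℝ, E).prod 𝓘(ℝ, E)) ∞
      (Subtype.val : Hor → Q × Q) ∧
    IsLocalDiffeomorph 𝓘(ℝ, EuclideanSpace ℝ (Fin k)) (𝓘(ℝ, E).prod 𝓘(ℝ, EB)) ∞
      (fun p : Hor =>
        (p.1.1, (Quotient.mk _ p.1.2 : MulAction.orbitRel.Quotient H Q)))

/-- The domain `𝔘 = {(q₀, h • q₁) : (q₀, q₁) ∈ Hor, h ∈ H}` of an affine discrete connection. -/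
def connectionDomain [MulAction G Q] (H : Subgroup G) (Hor : Set (Q × Q)) : Set (Q × Q) :=
  {p | ∃ h : H, ∃ q₁ : Q, (p.1, q₁) ∈ Hor ∧ p.2 = h • q₁}

end Action

end DiscreteMechanics

end

open DiscreteMechanics

/-!
Write `H = G_μ`, `𝔥` for its Lie algebra, `π : Q → Q/H` for the projection and `J` for the discrete
momentum map with values in `𝔥*`. The statements on existence, uniqueness and equivariance follow
algebraically from the uniqueness hypotheses on `J` and from the equivariance of `J` under `H`,
which turns into invariance of the level `J = μ` because `H` fixes `μ` (`smul_mem_momentumLevel`).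
Everything else comes from one fact: the map

  `(q₀, q₁) ↦ (q₀, π(q₁), J(q₀, q₁))`

is a local diffeomorphism (`isLocalDiffeomorphAt_quotient_momentumDefect`). By the inverse function
theorem it suffices that its derivative is bijective. The kernel of `Tπ` at `q₁` is the tangent
space of the orbit of `q₁`, and the derivative of `J(q₀, ·)` maps this space isomorphically onto
`𝔥*`: the derivative is the pairing `D₂D₁L` between the orbit directions at `q₀` and `q₁`, which is
nondegenerate by `H`-regularity, and `𝔥` is isomorphic to the tangent space of each orbit.

The two facts on orbits that enter here are proved without the exponential map and without the
closed subgroup theorem. If `ξ_Q(q) = 0` then the integral curve through `1` of the left-invariant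
vector field of `ξ` fixes `q`, so it is constant by freeness and `ξ = 0`
(`infinitesimalGenerator_injective`). Hence the orbit maps are immersions, and since the action is
proper, `g` depends smoothly on `q` and `g • q` (`contMDiffAt_of_smul`). Consequently a smooth curve
in an orbit of `H` is `t ↦ h(t) • q` with `h` smooth, so each vector in the kernel of `Tπ` is an
infinitesimal generator of an element of `𝔥` (`mem_verticalSpace_of_mfderiv_quotient_eq_zero`).

Restricted to the level `J = μ`, the local diffeomorphism shows that `id × π` is an open embedding
of the level in `Q × Q/H`. The smooth structure of the level is the one pulled back along it; the
inclusion in `Q × Q` is an embedding because `(id × π, J)` provides slice charts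
(`exists_chartedSpace_levelSet`). The domain is the preimage of an open set, and the level function
`γ` is smooth because `q ↦ (q, γ(q)q)` is the lift of `q ↦ (q, π(q))` to the level, followed by
division in the action.
-/

open DiscreteMechanics

namespace DiscreteMechanics

/-! ### The inverse function theorem on manifolds -/

section InverseFunction

/-- The inverse function theorem in normed spaces, with a smooth inverse on a whole neighbourhood:
smoothness at each point of the domain is a consequence of the invertibility of the derivative
there, which is an open condition. -/
theorem exists_openPartialHomeomorph_of_contDiffOn
    {E F : Type*} [NormedAddCommGroup E] [NormedSpace ℝ E] [NormedAddCommGroup F]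
    [NormedSpace ℝ F] [CompleteSpace E] {g : E → F} {W : Set E} (hW : IsOpen W)
    (hg : ContDiffOn ℝ ∞ g W) {a : E} (ha : a ∈ W) (g' : E ≃L[ℝ] F)
    (hg' : HasFDerivAt g (g' : E →L[ℝ] F) a) :
    ∃ T : OpenPartialHomeomorph E F, a ∈ T.source ∧ T.source ⊆ W ∧ (∀ x, T x = g x) ∧
      ContDiffOn ℝ ∞ T.symm T.target := by
  have hga : ContDiffAt ℝ ∞ g a := hg.contDiffAt (hW.mem_nhds ha)
  have hn : (∞ : ℕ∞ω) ≠ 0 := by simp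
  let T₀ := hga.toOpenPartialHomeomorph g hg' hn
  have hT₀ : ∀ x, T₀ x = g x := fun x => rfl
  have hcont : ContinuousOn (fderiv ℝ g) W := hg.continuousOn_fderiv_of_isOpen hW (by simp)
  have hopen : IsOpen (W ∩ fderiv ℝ g ⁻¹'
      Set.range ((↑) : (E ≃L[ℝ] F) → E →L[ℝ] F)) :=
    hcont.isOpen_inter_preimage hW ContinuousLinearEquiv.isOpen
  refine ⟨T₀.restrOpen _ hopen, ?_, ?_, hT₀, ?_⟩
  · refine ⟨hga.mem_toOpenPartialHomeomorph_source hg' hn, ha, g', hg'.fderiv.symm⟩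
  · rintro x ⟨-, hx, -⟩
    exact hx
  · intro y hy
    have hx := (T₀.restrOpen _ hopen).map_target hy
    obtain ⟨-, hxW, e, he⟩ := hx
    have hgx : ContDiffAt ℝ ∞ g ((T₀.restrOpen _ hopen).symm y) := hg.contDiffAt (hW.mem_nhds hxW)
    refine (OpenPartialHomeomorph.contDiffAt_symm (f₀' := e) (T₀.restrOpen _ hopen) hy ?_
      hgx).contDiffWithinAt
    rw [he]
    exact (hgx.differentiableAt hn).hasFDerivAt

variable {E : Type*} [NormedAddCommGroup E] [NormedSpace ℝ E] [FiniteDimensional ℝ E]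
  {F : Type*} [NormedAddCommGroup F] [NormedSpace ℝ F]
  {H : Type*} [TopologicalSpace H] {I : ModelWithCorners ℝ E H} [I.Boundaryless]
  {H' : Type*} [TopologicalSpace H'] {J : ModelWithCorners ℝ F H'}
  {M : Type*} [TopologicalSpace M] [ChartedSpace H M] [IsManifold I ∞ M]
  {N : Type*} [TopologicalSpace N] [ChartedSpace H' N] [IsManifold J ∞ N]

/-- The inverse function theorem: a map from a finite-dimensional manifold without boundary that is
smooth near `x` and whose derivative at `x` is bijective is a local diffeomorphism at `x`. -/
theorem isLocalDiffeomorphAt_of_bijective_mfderiv {f : M → N} {x : M}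
    (hf : ∀ᶠ y in 𝓝 x, ContMDiffAt I J ∞ f y)
    (hbij : Function.Bijective (mfderiv I J f x)) : IsLocalDiffeomorphAt I J ∞ f x := by
  have hn : (∞ : ℕ∞ω) ≠ 0 := by simp
  have hfx : ContMDiffAt I J ∞ f x := hf.self_of_nhds
  have hfψ : ∀ᶠ y in 𝓝 x, f y ∈ (extChartAt J (f x)).source :=
    hfx.continuousAt.eventually (extChartAt_source_mem_nhds (f x))
  obtain ⟨U, hU, hUo, hxU⟩ := mem_nhds_iff.1 (hf.and hfψ)
  -- the coordinates at `x` and at `f x`, and `f` read in them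
  let φ := extChartAt I x
  let ψ := extChartAt J (f x)
  let g : E → F := ψ ∘ f ∘ φ.symm
  let W : Set E := φ.target ∩ φ.symm ⁻¹' U
  have hWo : IsOpen W :=
    (continuousOn_extChartAt_symm x).isOpen_inter_preimage (isOpen_extChartAt_target x) hUo
  have hφx : φ.symm (φ x) = x := extChartAt_to_inv x
  have hxW : φ x ∈ W := ⟨mem_extChartAt_target x, by simpa [hφx] using hxU⟩
  have hfU : ContMDiffOn I J ∞ f U := fun y hy => (hU hy).1.contMDiffWithinAt
  have hg : ContDiffOn ℝ ∞ g W := by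
    rw [← contMDiffOn_iff_contDiffOn]
    refine (contMDiffOn_extChartAt (x := f x)).comp
      (t := (chartAt H' (f x)).source) (hfU.comp
      ((contMDiffOn_extChartAt_symm x).mono Set.inter_subset_left) fun y hy => hy.2) ?_
    intro y hy
    have := (hU hy.2).2
    rw [extChartAt_source] at this
    exact this
  have hgx : ContDiffAt ℝ ∞ g (φ x) := hg.contDiffAt (hWo.mem_nhds hxW)
  have hderiv : fderiv ℝ g (φ x) = mfderiv I J f x := by
    rw [(hfx.mdifferentiableAt hn).mfderiv, I.range_eq_univ, fderivWithin_univ]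
    rfl
  let L : E ≃L[ℝ] F := (LinearEquiv.ofBijective (fderiv ℝ g (φ x)).toLinearMap
    (by rw [hderiv]; exact hbij)).toContinuousLinearEquiv
  have hL : (L : E →L[ℝ] F) = fderiv ℝ g (φ x) := rfl
  obtain ⟨T, hxT, hTW, hTg, hTs⟩ := exists_openPartialHomeomorph_of_contDiffOn hWo hg hxW L
    (by rw [hL]; exact (hgx.differentiableAt hn).hasFDerivAt)
  have hgψ : ∀ y ∈ φ.source, y ∈ U → ψ.symm (g (φ y)) = f y := by
    intro y hy hyU
    have : φ.symm (φ y) = y := φ.left_inv hy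
    change ψ.symm (ψ (f (φ.symm (φ y)))) = f y
    rw [this]
    exact ψ.left_inv (hU hyU).2
  have hgt : ∀ z ∈ W, g z ∈ ψ.target := fun z hz => ψ.map_source (hU hz.2).2
  have hWs : ∀ z ∈ W, φ (φ.symm z) = z := fun z hz => φ.right_inv hz.1
  refine ⟨
    { toFun := f
      invFun := φ.symm ∘ T.symm ∘ ψ
      source := φ.source ∩ φ ⁻¹' T.source
      target := ψ.source ∩ ψ ⁻¹' T.target
      map_source' := ?_
      map_target' := ?_
      left_inv' := ?_
      right_inv' := ?_
      open_source := (continuousOn_extChartAt x).isOpen_inter_preimage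
        (isOpen_extChartAt_source x) T.open_source
      open_target := (continuousOn_extChartAt (f x)).isOpen_inter_preimage
        (isOpen_extChartAt_source (f x)) T.open_target
      contMDiffOn_toFun := ?_
      contMDiffOn_invFun := ?_ }, ⟨mem_extChartAt_source x, hxT⟩, fun _ _ => rfl⟩
  · rintro y ⟨hy, hyT⟩
    have hyU : y ∈ U := by
      have := (hTW hyT).2
      rwa [Set.mem_preimage, φ.left_inv hy] at this
    refine ⟨(hU hyU).2, ?_⟩
    have h1 : ψ (f y) = T (φ y) := by
      rw [hTg]
      change ψ (f y) = ψ (f (φ.symm (φ y)))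
      rw [φ.left_inv hy]
    rw [Set.mem_preimage, h1]
    exact T.map_source hyT
  · rintro z ⟨hz, hzT⟩
    have h1 := T.map_target hzT
    have h2 := hTW h1
    refine ⟨φ.map_target h2.1, ?_⟩
    change φ (φ.symm (T.symm (ψ z))) ∈ T.source
    rwa [hWs _ h2]
  · rintro y ⟨hy, hyT⟩
    have h1 : ψ (f y) = T (φ y) := by
      rw [hTg]
      change ψ (f y) = ψ (f (φ.symm (φ y)))
      rw [φ.left_inv hy]
    change φ.symm (T.symm (ψ (f y))) = y
    rw [h1, T.left_inv hyT, φ.left_inv hy]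
  · rintro z ⟨hz, hzT⟩
    have h1 := T.map_target hzT
    have h2 := hTW h1
    change f (φ.symm (T.symm (ψ z))) = z
    have h3 := hgψ _ (φ.map_target h2.1) h2.2
    rw [hWs _ h2, ← hTg, T.right_inv hzT, ψ.left_inv hz] at h3
    exact h3.symm
  · refine hfU.mono ?_
    rintro y ⟨hy, hyT⟩
    have := (hTW hyT).2
    rwa [Set.mem_preimage, φ.left_inv hy] at this
  · refine (contMDiffOn_extChartAt_symm x).comp ((contMDiffOn_iff_contDiffOn.2 hTs).comp
      ((contMDiffOn_extChartAt (x := f x)).mono ?_) fun z hz => hz.2) ?_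
    · intro z hz
      rw [← extChartAt_source J]
      exact hz.1
    · exact fun z hz => (hTW (T.map_target hz.2)).1

end InverseFunction

/-! ### Orbit maps of free and proper actions -/

section FreeProper

theorem contMDiff_translation (EG : Type*) [NormedAddCommGroup EG] [NormedSpace ℝ EG]
    {G : Type*} [TopologicalSpace G] [ChartedSpace EG G] [Group G]
    (E : Type*) [NormedAddCommGroup E] [NormedSpace ℝ E]
    {Q : Type*} [TopologicalSpace Q] [ChartedSpace E Q]
    [MulAction G Q] [ContMDiffSMul 𝓘(ℝ, EG) 𝓘(ℝ, E) ∞ G Q] (g : G) :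
    ContMDiff 𝓘(ℝ, E) 𝓘(ℝ, E) ∞ (fun q : Q => g • q) :=
  (ContMDiffSMul.contMDiff_smul (I := 𝓘(ℝ, EG)) (I' := 𝓘(ℝ, E)) (G := G) (M := Q)).comp
    (contMDiff_const.prodMk contMDiff_id)

variable {EG : Type*} [NormedAddCommGroup EG] [NormedSpace ℝ EG]
  {G : Type*} [TopologicalSpace G] [ChartedSpace EG G] [Group G]
  {E : Type*} [NormedAddCommGroup E] [NormedSpace ℝ E]
  {Q : Type*} [TopologicalSpace Q] [ChartedSpace E Q]
  [MulAction G Q] [ContMDiffSMul 𝓘(ℝ, EG) 𝓘(ℝ, E) ∞ G Q]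

theorem contMDiff_orbitMap (q : Q) :
    ContMDiff 𝓘(ℝ, EG) 𝓘(ℝ, E) ∞ (fun g : G => g • q) :=
  (contMDiff_smul (I := 𝓘(ℝ, EG)) (I' := 𝓘(ℝ, E)) (G := G) (M := Q)).comp
    (contMDiff_id.prodMk contMDiff_const)

theorem hasMFDerivAt_orbitMap (q : Q) (g : G) :
    HasMFDerivAt 𝓘(ℝ, EG) 𝓘(ℝ, E) (fun g : G => g • q) g
      (mfderiv 𝓘(ℝ, EG) 𝓘(ℝ, E) (fun g : G => g • q) g) :=
  ((contMDiff_orbitMap q).mdifferentiable (by simp) g).hasMFDerivAt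

variable [LieGroup 𝓘(ℝ, EG) ∞ G]

/-- If `ξ_Q(q) = 0`, the orbit map of `q` has derivative zero along the left-invariant vector
field of `ξ`. -/
theorem mfderiv_orbitMap_mulInvariantVectorField {q : Q} {ξ : GroupLieAlgebra 𝓘(ℝ, EG) G}
    (hξ : infinitesimalGenerator EG G E q ξ = 0) (g : G) :
    mfderiv 𝓘(ℝ, EG) 𝓘(ℝ, E) (fun g : G => g • q) g (mulInvariantVectorField ξ g) = 0 := by
  have hmul : HasMFDerivAt 𝓘(ℝ, EG) 𝓘(ℝ, EG) (g * ·) (1 : G)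
      (mfderiv 𝓘(ℝ, EG) 𝓘(ℝ, EG) (g * ·) (1 : G)) :=
    ((contMDiff_mul_left (I := 𝓘(ℝ, EG)) (n := ∞) (a := g)).mdifferentiable (by simp)
      1).hasMFDerivAt
  have htr : HasMFDerivAt 𝓘(ℝ, E) 𝓘(ℝ, E) (fun q : Q => g • q) ((1 : G) • q)
      (mfderiv 𝓘(ℝ, E) 𝓘(ℝ, E) (fun q : Q => g • q) ((1 : G) • q)) :=
    ((contMDiff_translation EG E g).mdifferentiable (by simp) _).hasMFDerivAt
  have h1 := (hasMFDerivAt_orbitMap (EG := EG) (E := E) q (g * 1)).comp (1 : G) hmul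
  have h2 := htr.comp (1 : G) (hasMFDerivAt_orbitMap (EG := EG) (E := E) q (1 : G))
  have e : (fun g : G => g • q) ∘ (g * ·) = (fun q : Q => g • q) ∘ fun g : G => g • q := by
    ext x; simp [mul_smul]
  rw [e] at h1
  have h3 := hasMFDerivAt_unique h1 h2
  have h4 := congrArg (fun T : EG →L[ℝ] E => T ξ) h3
  -- the base points `g * 1` and `g` are equal only propositionally
  have h5 : ∀ g' : G, g' = g → (mfderiv 𝓘(ℝ, EG) 𝓘(ℝ, E) (fun g : G => g • q) g' : EG →L[ℝ] E) =
      (mfderiv 𝓘(ℝ, EG) 𝓘(ℝ, E) (fun g : G => g • q) g : EG →L[ℝ] E) := by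
    rintro _ rfl; rfl
  refine (congrArg (fun T : EG →L[ℝ] E => T (mulInvariantVectorField ξ g))
    (h5 _ (mul_one g))).symm.trans (h4.trans ?_)
  refine (congrArg (fun v : E => (mfderiv 𝓘(ℝ, E) 𝓘(ℝ, E) (fun q : Q => g • q)
    ((1 : G) • q) : E →L[ℝ] E) v) hξ).trans ?_
  exact map_zero (mfderiv 𝓘(ℝ, E) 𝓘(ℝ, E) (fun q : Q => g • q) ((1 : G) • q) : E →L[ℝ] E)

/-- A curve in a manifold whose velocity vanishes near `0` is constant near `0`. -/
theorem eventually_eq_of_hasMFDerivAt_zero [IsManifold 𝓘(ℝ, E) ∞ Q] {c : ℝ → Q}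
    (hc : ∀ᶠ t in 𝓝 (0 : ℝ), HasMFDerivAt 𝓘(ℝ, ℝ) 𝓘(ℝ, E) c t (0 : ℝ →L[ℝ] E)) :
    ∀ᶠ t in 𝓝 (0 : ℝ), c t = c 0 := by
  have hc0 : ContinuousAt c 0 := hc.self_of_nhds.continuousAt
  have hsrc : ∀ᶠ t in 𝓝 (0 : ℝ), c t ∈ (extChartAt 𝓘(ℝ, E) (c 0)).source :=
    hc0.eventually (extChartAt_source_mem_nhds (c 0))
  obtain ⟨ε, hε, hball⟩ := Metric.eventually_nhds_iff_ball.1 (hc.and hsrc)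
  have hd : ∀ t ∈ Metric.ball (0 : ℝ) ε,
      HasDerivAt (fun t => extChartAt 𝓘(ℝ, E) (c 0) (c t)) 0 t := by
    intro t ht
    obtain ⟨h1, h2⟩ := hball t ht
    rw [extChartAt_source] at h2
    have h3 : MDifferentiableAt 𝓘(ℝ, E) 𝓘(ℝ, E) (extChartAt 𝓘(ℝ, E) (c 0)) (c t) :=
      mdifferentiableAt_extChartAt h2
    have h4 := h3.hasMFDerivAt.comp t h1
    have h5 : HasFDerivAt (fun t => extChartAt 𝓘(ℝ, E) (c 0) (c t)) (0 : ℝ →L[ℝ] E) t := by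
      refine HasMFDerivAt.hasFDerivAt (h4.congr_mfderiv ?_)
      exact ContinuousLinearMap.comp_zero
        (mfderiv 𝓘(ℝ, E) 𝓘(ℝ, E) (extChartAt 𝓘(ℝ, E) (c 0)) (c t) : E →L[ℝ] E)
    simpa using h5.hasDerivAt
  filter_upwards [Metric.ball_mem_nhds (0 : ℝ) hε] with t ht
  have h1 := Metric.isOpen_ball.is_const_of_deriv_eq_zero (convex_ball (0 : ℝ) ε).isPreconnected
    (fun s hs => (hd s hs).differentiableAt.differentiableWithinAt)
    (fun s hs => (hd s hs).deriv) ht (Metric.mem_ball_self hε)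
  exact (extChartAt 𝓘(ℝ, E) (c 0)).injOn (hball t ht).2 (mem_extChartAt_source _) h1

/-- The infinitesimal generators of a free action vanish nowhere: if `ξ_Q(q) = 0`, the integral
curve through `1` of the left-invariant vector field of `ξ` fixes `q`, so it is constant. -/
theorem infinitesimalGenerator_injective [FiniteDimensional ℝ EG] [IsManifold 𝓘(ℝ, E) ∞ Q]
    (hfree : ∀ (g : G) (q : Q), g • q = q → g = 1) (q : Q) :
    Function.Injective (infinitesimalGenerator EG G E q) := by
  rw [injective_iff_map_eq_zero]
  intro ξ hξ
  have : LieGroup 𝓘(ℝ, EG) (minSmoothness ℝ 3) G := LieGroup.of_le (n := ∞)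
    (by rw [minSmoothness_of_isRCLikeNormedField]; exact WithTop.coe_le_coe.2 le_top)
  have : IsManifold 𝓘(ℝ, EG) 1 G := IsManifold.of_le (n := ∞) (by simp)
  have hX : ContMDiffAt 𝓘(ℝ, EG) 𝓘(ℝ, EG).tangent 1
      (fun g : G => (mulInvariantVectorField ξ g : TangentBundle 𝓘(ℝ, EG) G)) 1 :=
    (contMDiffAt_mulInvariantVectorField ξ).of_le (by simp)
  obtain ⟨c, hc0, hc⟩ := exists_isMIntegralCurveAt_of_contMDiffAt_boundaryless 0 hX
  have hconst : ∀ᶠ t in 𝓝 (0 : ℝ), c t • q = c 0 • q := by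
    refine eventually_eq_of_hasMFDerivAt_zero (E := E) (hc.mono fun t ht => ?_)
    have h := (hasMFDerivAt_orbitMap (EG := EG) (E := E) q (c t)).comp t ht
    refine h.congr_mfderiv (ContinuousLinearMap.ext_ring ?_)
    exact (congrArg (mfderiv 𝓘(ℝ, EG) 𝓘(ℝ, E) (fun g : G => g • q) (c t) : EG →L[ℝ] E)
      (one_smul ℝ (mulInvariantVectorField ξ (c t) : EG))).trans
      (mfderiv_orbitMap_mulInvariantVectorField hξ (c t))
  have hone : c =ᶠ[𝓝 0] fun _ => (1 : G) := by
    filter_upwards [hconst] with t ht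
    rw [hc0, one_smul] at ht
    exact hfree _ _ ht
  have h0 := hc.self_of_nhds
  have h1 : HasMFDerivAt 𝓘(ℝ, ℝ) 𝓘(ℝ, EG) c 0 (0 : ℝ →L[ℝ] EG) :=
    (hasMFDerivAt_const (I := 𝓘(ℝ, ℝ)) (I' := 𝓘(ℝ, EG)) (1 : G) (0 : ℝ)).congr_of_eventuallyEq hone
  have h2 := congrArg (fun T : ℝ →L[ℝ] EG => T 1) (hasMFDerivAt_unique h0 h1)
  have h3 : (mulInvariantVectorField ξ (c 0) : EG) = 0 :=
    (one_smul ℝ (mulInvariantVectorField ξ (c 0) : EG)).symm.trans h2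
  rw [hc0] at h3
  have h4 : mulInvariantVectorField ξ (1 : G) = ξ := by
    have : ((1 : G) * ·) = id := by ext; simp
    have h5 : HasMFDerivAt 𝓘(ℝ, EG) 𝓘(ℝ, EG) ((1 : G) * ·) 1 (ContinuousLinearMap.id ℝ EG) := by
      rw [this]
      exact hasMFDerivAt_id 1
    exact congrArg (fun T : EG →L[ℝ] EG => T ξ) h5.mfderiv
  exact h4.symm.trans h3

end FreeProper

section Division

variable {EG : Type*} [NormedAddCommGroup EG] [NormedSpace ℝ EG] [FiniteDimensional ℝ EG]
  {G : Type*} [TopologicalSpace G] [ChartedSpace EG G] [Group G] [LieGroup 𝓘(ℝ, EG) ∞ G]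
  {E : Type*} [NormedAddCommGroup E] [NormedSpace ℝ E] [FiniteDimensional ℝ E]
  {Q : Type*} [TopologicalSpace Q] [ChartedSpace E Q] [IsManifold 𝓘(ℝ, E) ∞ Q]
  [MulAction G Q] [ContMDiffSMul 𝓘(ℝ, EG) 𝓘(ℝ, E) ∞ G Q]

/-- For a free and proper action, `(g, q) ↦ (g • q, q)` is a closed embedding. -/
theorem isClosedEmbedding_smul_pair {G Q : Type*} [TopologicalSpace G] [Group G]
    [TopologicalSpace Q] [MulAction G Q] [ProperSMul G Q]
    (hfree : ∀ (g : G) (q : Q), g • q = q → g = 1) :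
    Topology.IsClosedEmbedding (fun p : G × Q => (p.1 • p.2, p.2)) := by
  refine .of_continuous_injective_isClosedMap ProperSMul.isProperMap_smul_pair.continuous ?_
    ProperSMul.isProperMap_smul_pair.isClosedMap
  rintro ⟨g, q⟩ ⟨g', q'⟩ h
  obtain ⟨h1, h2⟩ := Prod.mk.inj h
  obtain rfl : q = q' := h2
  have h3 : (g'⁻¹ * g) • q = q := by
    rw [mul_smul, show g • q = g' • q from h1, inv_smul_smul]
  rw [inv_mul_eq_one.1 (hfree _ _ h3)]

/-- At a point `q₀`, the map `(g, q) ↦ (p(g • q), q)` is a local diffeomorphism at `(1, q₀)` for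
a suitable smooth `p : Q → EG` defined near `q₀`: the derivative of the orbit map is injective, and
`p` extends a linear left inverse of it. -/
theorem exists_isLocalDiffeomorphAt_smul
    (hfree : ∀ (g : G) (q : Q), g • q = q → g = 1) (q₀ : Q) :
    ∃ p : Q → EG, ContMDiffAt 𝓘(ℝ, E) 𝓘(ℝ, EG) ∞ p q₀ ∧
      IsLocalDiffeomorphAt (𝓘(ℝ, EG).prod 𝓘(ℝ, E)) (𝓘(ℝ, EG).prod 𝓘(ℝ, E)) ∞
        (fun z : G × Q => (p (z.1 • z.2), z.2)) (1, q₀) := by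
  have : IsManifold 𝓘(ℝ, E) 1 Q := IsManifold.of_le (n := ∞) (by simp)
  let φ := extChartAt 𝓘(ℝ, E) q₀
  have hφ : ContMDiffOn 𝓘(ℝ, E) 𝓘(ℝ, E) ∞ φ (chartAt E q₀).source := contMDiffOn_extChartAt
  let Dφ : E →L[ℝ] E := mfderiv 𝓘(ℝ, E) 𝓘(ℝ, E) φ q₀
  let A : EG →L[ℝ] E := infinitesimalGenerator EG G E q₀
  have hA : Function.Injective A := infinitesimalGenerator_injective hfree q₀
  have hDφ : Function.Injective Dφ := by
    obtain ⟨e, he⟩ := isInvertible_mfderiv_extChartAt (I := 𝓘(ℝ, E)) (mem_extChartAt_source q₀)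
    change Function.Injective (mfderiv 𝓘(ℝ, E) 𝓘(ℝ, E) φ q₀)
    rw [← he]
    exact e.injective
  obtain ⟨P, hP⟩ := (Dφ.comp A).toLinearMap.exists_leftInverse_of_injective
    (LinearMap.ker_eq_bot.2 (hDφ.comp hA))
  let P' : E →L[ℝ] EG := P.toContinuousLinearMap
  let p : Q → EG := fun q => P' (φ q)
  have hpon : ContMDiffOn 𝓘(ℝ, E) 𝓘(ℝ, EG) ∞ p (chartAt E q₀).source :=
    P'.contMDiff.comp_contMDiffOn hφ
  have hsrc : ∀ᶠ q in 𝓝 q₀, q ∈ (chartAt E q₀).source :=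
    (chartAt E q₀).open_source.mem_nhds (mem_chart_source E q₀)
  have hpev : ∀ᶠ q in 𝓝 q₀, ContMDiffAt 𝓘(ℝ, E) 𝓘(ℝ, EG) ∞ p q := by
    filter_upwards [hsrc] with q hq
    exact hpon.contMDiffAt ((chartAt E q₀).open_source.mem_nhds hq)
  have hact : ContMDiff (𝓘(ℝ, EG).prod 𝓘(ℝ, E)) 𝓘(ℝ, E) ∞ (fun z : G × Q => z.1 • z.2) :=
    ContMDiffSMul.contMDiff_smul
  have hev : ∀ᶠ z : G × Q in 𝓝 (1, q₀),
      ContMDiffAt (𝓘(ℝ, EG).prod 𝓘(ℝ, E)) (𝓘(ℝ, EG).prod 𝓘(ℝ, E)) ∞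
        (fun z : G × Q => (p (z.1 • z.2), z.2)) z := by
    have h1 : Filter.Tendsto (fun z : G × Q => z.1 • z.2) (𝓝 (1, q₀)) (𝓝 q₀) := by
      have := hact.continuous.tendsto (1, q₀)
      simpa using this
    filter_upwards [h1.eventually hpev] with z hz
    exact (hz.comp z hact.contMDiffAt).prodMk contMDiffAt_snd
  refine ⟨p, hpev.self_of_nhds, isLocalDiffeomorphAt_of_bijective_mfderiv hev ?_⟩
  have hp1 : ContMDiffAt (𝓘(ℝ, EG).prod 𝓘(ℝ, E)) 𝓘(ℝ, EG) ∞
      (fun z : G × Q => p (z.1 • z.2)) (1, q₀) := by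
    refine ContMDiffAt.comp (g := p) (1, q₀) ?_ hact.contMDiffAt
    simpa using hpev.self_of_nhds
  have hmd := hp1.mdifferentiableAt (by simp)
  have hD : mfderiv (𝓘(ℝ, EG).prod 𝓘(ℝ, E)) (𝓘(ℝ, EG).prod 𝓘(ℝ, E))
      (fun z : G × Q => (p (z.1 • z.2), z.2)) (1, q₀) =
      (mfderiv (𝓘(ℝ, EG).prod 𝓘(ℝ, E)) 𝓘(ℝ, EG) (fun z : G × Q => p (z.1 • z.2)) (1, q₀)).prod
        (ContinuousLinearMap.snd ℝ EG E) :=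
    (hmd.hasMFDerivAt.prodMk (hasMFDerivAt_snd (1, q₀))).mfderiv
  -- along the group, the first component has the identity as derivative
  have hid : HasMFDerivAt 𝓘(ℝ, EG) 𝓘(ℝ, EG) (fun g : G => p (g • q₀)) 1
      (ContinuousLinearMap.id ℝ EG) := by
    have h1 : HasMFDerivAt 𝓘(ℝ, EG) 𝓘(ℝ, E) (fun g : G => g • q₀) 1 A :=
      hasMFDerivAt_orbitMap q₀ 1
    have h2 : HasMFDerivAt 𝓘(ℝ, E) 𝓘(ℝ, E) φ ((1 : G) • q₀) Dφ := by
      rw [one_smul]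
      exact (mdifferentiableAt_extChartAt (mem_chart_source E q₀)).hasMFDerivAt
    have h3 : HasMFDerivAt 𝓘(ℝ, E) 𝓘(ℝ, EG) P' (φ ((1 : G) • q₀)) P' :=
      P'.hasMFDerivAt
    refine (h3.comp (1 : G) (h2.comp (1 : G) h1)).congr_mfderiv ?_
    ext ξ
    exact congrArg (fun T : EG →ₗ[ℝ] EG => T ξ) hP
  have hinj : Function.Injective (mfderiv (𝓘(ℝ, EG).prod 𝓘(ℝ, E)) (𝓘(ℝ, EG).prod 𝓘(ℝ, E))
      (fun z : G × Q => (p (z.1 • z.2), z.2)) (1, q₀) : EG × E →L[ℝ] EG × E) := by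
    rw [injective_iff_map_eq_zero]
    rintro ⟨ξ, v⟩ h
    rw [hD] at h
    obtain ⟨h1, h2⟩ := Prod.mk.inj h
    obtain rfl : v = 0 := h2
    have h3 := mfderiv_prod_eq_add_apply (v := ((ξ, 0) : EG × E)) hmd
    have h4 : (mfderiv 𝓘(ℝ, E) 𝓘(ℝ, EG) (fun z : Q => p ((1 : G) • z)) q₀ : E →L[ℝ] EG) 0 = 0 :=
      map_zero _
    have h5 : (mfderiv 𝓘(ℝ, EG) 𝓘(ℝ, EG) (fun g : G => p (g • q₀)) 1 : EG →L[ℝ] EG) ξ = ξ :=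
      congrArg (fun T : EG →L[ℝ] EG => T ξ) hid.mfderiv
    have h6 : (0 : EG) = ξ + 0 := h1.symm.trans (h3.trans (congrArg₂ (fun a b : EG => a + b) h5 h4))
    rw [add_zero] at h6
    rw [← h6]
    rfl
  have hsurj : ∀ T : EG × E →L[ℝ] EG × E, Function.Injective T → Function.Surjective T :=
    fun T hT => LinearMap.surjective_of_injective (f := T.toLinearMap) hT
  exact ⟨hinj, hsurj _ hinj⟩

variable {EM : Type*} [NormedAddCommGroup EM] [NormedSpace ℝ EM] {HM : Type*} [TopologicalSpace HM]
  {IM : ModelWithCorners ℝ EM HM} {M : Type*} [TopologicalSpace M] [ChartedSpace HM M]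

/-- Division in a free and proper action is smooth: if `a` and `b • a` are smooth, so is the
`G`-valued map `b`. -/
theorem contMDiffAt_of_smul [ProperSMul G Q] (hfree : ∀ (g : G) (q : Q), g • q = q → g = 1)
    {a : M → Q} {b : M → G} {x : M} (ha : ContMDiffAt IM 𝓘(ℝ, E) ∞ a x)
    (hba : ContMDiffAt IM 𝓘(ℝ, E) ∞ (fun y => b y • a y) x) :
    ContMDiffAt IM 𝓘(ℝ, EG) ∞ b x := by
  -- translating by `(b x)⁻¹`, one may assume that `b x = 1`
  wlog hb : b x = 1 generalizing b
  · have h1 : ContMDiffAt IM 𝓘(ℝ, EG) ∞ (fun y => (b x)⁻¹ * b y) x := by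
      refine this ?_ (by simp)
      simp only [mul_smul]
      exact (contMDiff_translation EG E (b x)⁻¹).contMDiffAt.comp x hba
    have h2 := (contMDiff_mul_left (I := 𝓘(ℝ, EG)) (n := ∞) (a := b x)).contMDiffAt.comp x h1
    simpa [Function.comp_def] using h2
  have hc : ContinuousAt (fun y => (b y, a y)) x := by
    rw [(isClosedEmbedding_smul_pair hfree).isInducing.continuousAt_iff]
    exact hba.continuousAt.prodMk ha.continuousAt
  obtain ⟨p, hp, hR⟩ := exists_isLocalDiffeomorphAt_smul (EG := EG) (E := E) hfree (a x)
  have hR' : IsLocalDiffeomorphAt (𝓘(ℝ, EG).prod 𝓘(ℝ, E)) (𝓘(ℝ, EG).prod 𝓘(ℝ, E)) ∞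
        (fun z : G × Q => (p (z.1 • z.2), z.2)) (b x, a x) := by rwa [hb]
  have hev := hc.eventually hR'.localInverse_eventuallyEq_left
  have hpb : ContMDiffAt 𝓘(ℝ, E) 𝓘(ℝ, EG) ∞ p (b x • a x) := by rwa [hb, one_smul]
  have hs : ContMDiffAt IM (𝓘(ℝ, EG).prod 𝓘(ℝ, E)) ∞
      (fun y => hR'.localInverse (p (b y • a y), a y)) x :=
    ContMDiffAt.comp (g := hR'.localInverse) (f := fun y => (p (b y • a y), a y)) x
      hR'.localInverse_contMDiffAt ((hpb.comp x hba).prodMk ha)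
  refine (contMDiffAt_fst.comp x hs).congr_of_eventuallyEq ?_
  filter_upwards [hev] with y hy
  exact (congrArg Prod.fst hy).symm

end Division

/-! ### Submersions and the tangent spaces of orbits -/

section Submersion

variable {E : Type*} [NormedAddCommGroup E] [NormedSpace ℝ E]
  {Q : Type*} [TopologicalSpace Q] [ChartedSpace E Q]
  {EB : Type*} [NormedAddCommGroup EB] [NormedSpace ℝ EB]
  {B : Type*} [TopologicalSpace B] [ChartedSpace EB B]
  {π : Q → B} {q : Q}

/-- The normal form of a submersion at a point: in a chart `d` of the source it is a surjective
continuous linear map `p`, up to an injective smooth map `ψ` with injective derivative. -/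
theorem exists_chart_of_isSubmersionAt (h : Manifold.IsSubmersionAt 𝓘(ℝ, E) 𝓘(ℝ, EB) ∞ π q) :
    ∃ (d : OpenPartialHomeomorph Q E) (ψ : OpenPartialHomeomorph B EB) (p : E →L[ℝ] EB),
      d ∈ IsManifold.maximalAtlas 𝓘(ℝ, E) ∞ Q ∧ ψ ∈ IsManifold.maximalAtlas 𝓘(ℝ, EB) ∞ B ∧
      q ∈ d.source ∧ (∀ x ∈ d.source, π x ∈ ψ.source) ∧ Function.Surjective p ∧
      ∀ x ∈ d.source, ψ (π x) = p (d x) := by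
  refine ⟨h.domChart, h.codChart,
    (ContinuousLinearMap.fst ℝ EB h.complement).comp (h.equiv : E →L[ℝ] EB × h.complement),
    h.domChart_mem_maximalAtlas, h.codChart_mem_maximalAtlas, h.mem_domChart_source,
    h.source_subset_preimage_source, ?_, ?_⟩
  · exact Prod.fst_surjective.comp h.equiv.surjective
  · intro x hx
    have hx' : h.domChart x ∈ (h.domChart.extend 𝓘(ℝ, E)).target := by
      simpa using h.domChart.map_source hx
    have h1 := h.writtenInCharts hx'
    simpa [h.domChart.left_inv hx] using h1

theorem mdifferentiable_of_mem_maximalAtlas {d : OpenPartialHomeomorph Q E}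
    (hd : d ∈ IsManifold.maximalAtlas 𝓘(ℝ, E) ∞ Q) : d.MDifferentiable 𝓘(ℝ, E) 𝓘(ℝ, E) :=
  ⟨(contMDiffOn_of_mem_maximalAtlas hd).mdifferentiableOn (by simp),
    (contMDiffOn_symm_of_mem_maximalAtlas hd).mdifferentiableOn (by simp)⟩

theorem mfderiv_chart_comp_submersion {d : OpenPartialHomeomorph Q E}
    {ψ : OpenPartialHomeomorph B EB} {p : E →L[ℝ] EB} (hπ : MDifferentiableAt 𝓘(ℝ, E) 𝓘(ℝ, EB) π q)
    (hd : d ∈ IsManifold.maximalAtlas 𝓘(ℝ, E) ∞ Q) (hψ : ψ ∈ IsManifold.maximalAtlas 𝓘(ℝ, EB) ∞ B)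
    (hq : q ∈ d.source) (hqψ : π q ∈ ψ.source) (hp : ∀ x ∈ d.source, ψ (π x) = p (d x)) (w : E) :
    (mfderiv 𝓘(ℝ, EB) 𝓘(ℝ, EB) ψ (π q) : EB →L[ℝ] EB)
      ((mfderiv 𝓘(ℝ, E) 𝓘(ℝ, EB) π q : E →L[ℝ] EB) w) =
      p ((mfderiv 𝓘(ℝ, E) 𝓘(ℝ, E) d q : E →L[ℝ] E) w) := by
  have h1 := ((mdifferentiable_of_mem_maximalAtlas hψ).mdifferentiableAt hqψ).hasMFDerivAt.comp q
    hπ.hasMFDerivAt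
  have h2 := (p.hasMFDerivAt (x := d q)).comp q
    ((mdifferentiable_of_mem_maximalAtlas hd).mdifferentiableAt hq).hasMFDerivAt
  have h3 : ψ ∘ π =ᶠ[𝓝 q] p ∘ d := by
    filter_upwards [d.open_source.mem_nhds hq] with x hx using hp x hx
  have h4 := hasMFDerivAt_unique h1 (h2.congr_of_eventuallyEq h3)
  exact congrArg (fun T : E →L[ℝ] EB => T w) h4

theorem mfderiv_surjective_of_isSubmersionAt
    (h : Manifold.IsSubmersionAt 𝓘(ℝ, E) 𝓘(ℝ, EB) ∞ π q) :
    Function.Surjective (mfderiv 𝓘(ℝ, E) 𝓘(ℝ, EB) π q) := by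
  obtain ⟨d, ψ, p, hd, hψ, hq, hmaps, hsurj, hp⟩ := exists_chart_of_isSubmersionAt h
  intro u
  obtain ⟨e, he⟩ := hsurj ((mfderiv 𝓘(ℝ, EB) 𝓘(ℝ, EB) ψ (π q) : EB →L[ℝ] EB) u)
  obtain ⟨w, hw⟩ := (mdifferentiable_of_mem_maximalAtlas hd).mfderiv_surjective hq e
  refine ⟨w, (mdifferentiable_of_mem_maximalAtlas hψ).mfderiv_injective (hmaps q hq) ?_⟩
  refine (mfderiv_chart_comp_submersion (h.contMDiffAt.mdifferentiableAt (by simp)) hd hψ hq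
    (hmaps q hq) hp w).trans ?_
  exact (congrArg p hw).trans he

/-- A vector killed by the derivative of a submersion is the velocity of a smooth curve in the
fibre. -/
theorem exists_curve_in_fibre (h : Manifold.IsSubmersionAt 𝓘(ℝ, E) 𝓘(ℝ, EB) ∞ π q) {w : E}
    (hw : (mfderiv 𝓘(ℝ, E) 𝓘(ℝ, EB) π q : E →L[ℝ] EB) w = 0) :
    ∃ c : ℝ → Q, c 0 = q ∧ (∀ᶠ t in 𝓝 (0 : ℝ), ContMDiffAt 𝓘(ℝ, ℝ) 𝓘(ℝ, E) ∞ c t) ∧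
      (∀ᶠ t in 𝓝 (0 : ℝ), π (c t) = π q) ∧
      (mfderiv 𝓘(ℝ, ℝ) 𝓘(ℝ, E) c 0 : ℝ →L[ℝ] E) 1 = w := by
  obtain ⟨d, ψ, p, hd, hψ, hq, hmaps, hsurj, hp⟩ := exists_chart_of_isSubmersionAt h
  let D : E →L[ℝ] E := mfderiv 𝓘(ℝ, E) 𝓘(ℝ, E) d q
  have hDw : p (D w) = 0 := by
    refine (mfderiv_chart_comp_submersion (h.contMDiffAt.mdifferentiableAt (by simp)) hd hψ hq
      (hmaps q hq) hp w).symm.trans ?_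
    rw [hw]
    exact map_zero _
  let l : ℝ → E := fun t => d q + t • D w
  have hl : ContDiff ℝ ∞ l := by fun_prop
  have hl0 : l 0 = d q := by simp [l]
  have hlt : ∀ᶠ t in 𝓝 (0 : ℝ), l t ∈ d.target := by
    refine hl.continuous.continuousAt.eventually (d.open_target.mem_nhds ?_)
    rw [hl0]
    exact d.map_source hq
  refine ⟨fun t => d.symm (l t), by simp [hl0, d.left_inv hq], ?_, ?_, ?_⟩
  · filter_upwards [hlt] with t ht
    exact (contMDiffAt_symm_of_mem_maximalAtlas hd ht).comp t hl.contMDiff.contMDiffAt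
  · filter_upwards [hlt] with t ht
    have h1 := d.map_target ht
    refine ψ.injOn (hmaps _ h1) (hmaps q hq) ?_
    rw [hp _ h1, hp q hq, d.right_inv ht]
    simp [l, hDw]
  · have h1 : HasMFDerivAt 𝓘(ℝ, ℝ) 𝓘(ℝ, E) l 0
        (ContinuousLinearMap.smulRight (1 : ℝ →L[ℝ] ℝ) (D w)) := by
      have : HasDerivAt l (D w) 0 := by
        have := ((hasDerivAt_id (0 : ℝ)).smul_const (D w)).const_add (d q)
        rwa [one_smul] at this
      exact this.hasFDerivAt.hasMFDerivAt
    have hd' := mdifferentiable_of_mem_maximalAtlas hd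
    have h2 : HasMFDerivAt 𝓘(ℝ, E) 𝓘(ℝ, E) d.symm (l 0)
        (mfderiv 𝓘(ℝ, E) 𝓘(ℝ, E) d.symm (d q)) := by
      rw [hl0]
      exact (hd'.mdifferentiableAt_symm (d.map_source hq)).hasMFDerivAt
    have h3 := congrArg (fun T : ℝ →L[ℝ] E => T 1) (h2.comp (0 : ℝ) h1).mfderiv
    have h4 := congrArg (fun T : E →L[ℝ] E => T w) (hd'.symm_comp_deriv hq)
    refine h3.trans (Eq.trans ?_ h4)
    exact congrArg (mfderiv 𝓘(ℝ, E) 𝓘(ℝ, E) d.symm (d q) : E →L[ℝ] E) (one_smul ℝ (D w))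

end Submersion

section Vertical

variable {EG : Type*} [NormedAddCommGroup EG] [NormedSpace ℝ EG]
  {G : Type*} [TopologicalSpace G] [ChartedSpace EG G] [Group G]
  {E : Type*} [NormedAddCommGroup E] [NormedSpace ℝ E]
  {Q : Type*} [TopologicalSpace Q] [ChartedSpace E Q]
  [MulAction G Q] [ContMDiffSMul 𝓘(ℝ, EG) 𝓘(ℝ, E) ∞ G Q]
  {EB : Type*} [NormedAddCommGroup EB] [NormedSpace ℝ EB]
  {H : Subgroup G} [ChartedSpace EB (MulAction.orbitRel.Quotient H Q)]

theorem infinitesimalGenerator_velocity {c : ℝ → G}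
    (hc : MDifferentiableAt 𝓘(ℝ, ℝ) 𝓘(ℝ, EG) c 0) (hc0 : c 0 = 1) (q : Q) :
    infinitesimalGenerator EG G E q (velocity EG c) =
      (mfderiv 𝓘(ℝ, ℝ) 𝓘(ℝ, E) (fun t => c t • q) 0 : ℝ →L[ℝ] E) 1 := by
  have h1 : HasMFDerivAt 𝓘(ℝ, EG) 𝓘(ℝ, E) (fun g : G => g • q) (c 0)
      (infinitesimalGenerator EG G E q) := by
    rw [hc0]
    exact hasMFDerivAt_orbitMap q 1
  have h2 := (h1.comp (0 : ℝ) hc.hasMFDerivAt).mfderiv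
  exact (congrArg (fun T : ℝ →L[ℝ] E => T 1) h2).symm

variable [LieGroup 𝓘(ℝ, EG) ∞ G]

theorem mfderiv_quotient_eq_zero_of_mem_verticalSpace {q : Q}
    (hπ : MDifferentiableAt 𝓘(ℝ, E) 𝓘(ℝ, EB)
      (Quotient.mk _ : Q → MulAction.orbitRel.Quotient H Q) q) {w : E}
    (hw : w ∈ verticalSpace EG E H q) :
    (mfderiv 𝓘(ℝ, E) 𝓘(ℝ, EB) (Quotient.mk _ : Q → MulAction.orbitRel.Quotient H Q) q :
      E →L[ℝ] EB) w = 0 := by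
  obtain ⟨ξ, ⟨c, hc, hc0, hcH, rfl⟩, rfl⟩ := hw
  have hcq : ContMDiff 𝓘(ℝ, ℝ) 𝓘(ℝ, E) ∞ (fun t => c t • q) :=
    (contMDiff_orbitMap (EG := EG) q).comp hc
  have e1 := infinitesimalGenerator_velocity (E := E) (hc.mdifferentiable (by simp) 0) hc0 q
  have hπ' : HasMFDerivAt 𝓘(ℝ, E) 𝓘(ℝ, EB)
      (Quotient.mk _ : Q → MulAction.orbitRel.Quotient H Q) (c 0 • q)
      (mfderiv 𝓘(ℝ, E) 𝓘(ℝ, EB) (Quotient.mk _ : Q → MulAction.orbitRel.Quotient H Q) q) := by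
    rw [hc0, one_smul]
    exact hπ.hasMFDerivAt
  have h1 := hπ'.comp (0 : ℝ) (hcq.mdifferentiable (by simp) 0).hasMFDerivAt
  have h2 : (Quotient.mk _ : Q → MulAction.orbitRel.Quotient H Q) ∘ (fun t => c t • q) =
      fun _ => Quotient.mk _ q := by
    ext t
    exact Quotient.sound ⟨⟨c t, hcH t⟩, rfl⟩
  rw [h2] at h1
  have h3 := congrArg (fun T : ℝ →L[ℝ] EB => T 1)
    (hasMFDerivAt_unique h1 (hasMFDerivAt_const _ _))
  exact (congrArg (mfderiv 𝓘(ℝ, E) 𝓘(ℝ, EB)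
    (Quotient.mk _ : Q → MulAction.orbitRel.Quotient H Q) q : E →L[ℝ] EB) e1).trans h3

/-- The kernel of the derivative of the projection to the orbit space is spanned by infinitesimal
generators of elements of the Lie algebra of `H`: a curve in the orbit of `q` is of the form
`t ↦ h(t) • q`, and `h` is smooth because division in a free and proper action is. -/
theorem mem_verticalSpace_of_mfderiv_quotient_eq_zero [FiniteDimensional ℝ EG]
    [FiniteDimensional ℝ E] [IsManifold 𝓘(ℝ, E) ∞ Q] [ProperSMul G Q]
    [IsManifold 𝓘(ℝ, EB) ∞ (MulAction.orbitRel.Quotient H Q)]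
    (hfree : ∀ (g : G) (q : Q), g • q = q → g = 1) {q : Q}
    (hπ : Manifold.IsSubmersionAt 𝓘(ℝ, E) 𝓘(ℝ, EB) ∞
      (Quotient.mk _ : Q → MulAction.orbitRel.Quotient H Q) q) {w : E}
    (hw : (mfderiv 𝓘(ℝ, E) 𝓘(ℝ, EB) (Quotient.mk _ : Q → MulAction.orbitRel.Quotient H Q) q :
      E →L[ℝ] EB) w = 0) :
    w ∈ verticalSpace EG E H q := by
  obtain ⟨c, hc0, hc, hcπ, hcw⟩ := exists_curve_in_fibre hπ hw
  have hex : ∀ᶠ t in 𝓝 (0 : ℝ), ∃ h : H, h • q = c t := by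
    filter_upwards [hcπ] with t ht
    exact Quotient.exact ht
  obtain ⟨ε, hε, hball⟩ := Metric.eventually_nhds_iff_ball.1 (hc.and hex)
  choose! h hh using fun t ht => (hball t ht).2
  have hh' : ∀ t ∈ Metric.ball (0 : ℝ) ε, (h t : G) • q = c t := hh
  have hsmooth : ContMDiffOn 𝓘(ℝ, ℝ) 𝓘(ℝ, EG) ∞ (fun t => (h t : G)) (Metric.ball (0 : ℝ) ε) := by
    intro t ht
    refine ContMDiffAt.contMDiffWithinAt (contMDiffAt_of_smul (E := E) hfree
      (a := fun _ => q) contMDiffAt_const ((hball t ht).1.congr_of_eventuallyEq ?_))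
    filter_upwards [Metric.isOpen_ball.mem_nhds ht] with s hs using hh' s hs
  -- a reparametrization of the line onto a compact part of the interval, with velocity one at `0`
  let r : ℝ → ℝ := fun t => ε / 2 * Real.sin (2 / ε * t)
  have hr : ContDiff ℝ ∞ r := by fun_prop
  have hr0 : r 0 = 0 := by simp [r]
  have hrball : ∀ t, r t ∈ Metric.ball (0 : ℝ) ε := by
    intro t
    rw [mem_ball_zero_iff, Real.norm_eq_abs, abs_mul, abs_of_pos (half_pos hε)]
    nlinarith [Real.abs_sin_le_one (2 / ε * t)]
  have hrd : HasDerivAt r 1 0 := by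
    have h1 : HasDerivAt (fun t : ℝ => 2 / ε * t) (2 / ε) 0 := by
      simpa using (hasDerivAt_id (0 : ℝ)).const_mul (2 / ε)
    have h2 := (h1.sin).const_mul (ε / 2)
    refine h2.congr_deriv ?_
    rw [mul_zero, Real.cos_zero]
    field_simp
  have hk : ContMDiff 𝓘(ℝ, ℝ) 𝓘(ℝ, EG) ∞ (fun t => (h (r t) : G)) := by
    intro t
    exact (hsmooth.contMDiffAt (Metric.isOpen_ball.mem_nhds (hrball t))).comp t
      hr.contMDiff.contMDiffAt
  have hk0 : (h (r 0) : G) = 1 := by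
    refine hfree _ q ?_
    rw [hh' _ (hrball 0), hr0, hc0]
  refine ⟨velocity EG (fun t => (h (r t) : G)),
    ⟨fun t => (h (r t) : G), hk, hk0, fun t => (h (r t)).2, rfl⟩, ?_⟩
  refine (infinitesimalGenerator_velocity (E := E) (hk.mdifferentiable (by simp) 0) hk0 q).trans ?_
  have e : (fun t => (h (r t) : G) • q) = c ∘ r := by
    ext t
    exact hh' _ (hrball t)
  have h1 : HasMFDerivAt 𝓘(ℝ, ℝ) 𝓘(ℝ, E) c (r 0) (mfderiv 𝓘(ℝ, ℝ) 𝓘(ℝ, E) c 0) := by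
    rw [hr0]
    exact (hc.self_of_nhds.mdifferentiableAt (by simp)).hasMFDerivAt
  have h2 := h1.comp (0 : ℝ) hrd.hasFDerivAt.hasMFDerivAt
  rw [← e] at h2
  refine (congrArg (fun T : ℝ →L[ℝ] E => T 1) h2.mfderiv).trans (Eq.trans ?_ hcw)
  exact congrArg (mfderiv 𝓘(ℝ, ℝ) 𝓘(ℝ, E) c 0 : ℝ →L[ℝ] E) (one_smul ℝ (1 : ℝ))

end Vertical

/-! ### The discrete momentum map -/

section Momentum

variable {EG : Type*} [NormedAddCommGroup EG] [NormedSpace ℝ EG]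
  {G : Type*} [TopologicalSpace G] [ChartedSpace EG G] [Group G]
  {E : Type*} [NormedAddCommGroup E] [NormedSpace ℝ E]
  {Q : Type*} [TopologicalSpace Q] [ChartedSpace E Q]
  [MulAction G Q]

variable (EG G) in
/-- The derivative at `1` of `g ↦ L(g • q₀, q₁)`: minus the momentum map of the whole group `G`.
It takes values in the fixed vector space of linear forms on the model space of `G`. -/
noncomputable def orbitDerivative (L : Q × Q → ℝ) (q₀ q₁ : Q) : EG →L[ℝ] ℝ :=
  mfderiv 𝓘(ℝ, EG) 𝓘(ℝ, ℝ) (fun g : G => L (g • q₀, q₁)) 1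

variable (EG G E) in
/-- The derivative of `orbitDerivative L q₀ q₁` with respect to `q₁`. -/
noncomputable def orbitDerivative₂ (L : Q × Q → ℝ) (q₀ q₁ : Q) : E →L[ℝ] EG →L[ℝ] ℝ :=
  mfderiv 𝓘(ℝ, E) 𝓘(ℝ, EG →L[ℝ] ℝ) (fun y : Q => orbitDerivative EG G L q₀ y) q₁

variable [ContMDiffSMul 𝓘(ℝ, EG) 𝓘(ℝ, E) ∞ G Q]
  {L : Q × Q → ℝ} (hL : ContMDiff (𝓘(ℝ, E).prod 𝓘(ℝ, E)) 𝓘(ℝ, ℝ) ∞ L)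

include hL

theorem D₁_infinitesimalGenerator (q₀ q₁ : Q) (ξ : EG) :
    D₁ E L q₀ q₁ (infinitesimalGenerator EG G E q₀ ξ) = orbitDerivative EG G L q₀ q₁ ξ := by
  have h1 : ContMDiff 𝓘(ℝ, E) 𝓘(ℝ, ℝ) ∞ (fun x : Q => L (x, q₁)) :=
    hL.comp (contMDiff_id.prodMk contMDiff_const)
  have h2 : HasMFDerivAt 𝓘(ℝ, E) 𝓘(ℝ, ℝ) (fun x : Q => L (x, q₁)) ((1 : G) • q₀)
      (D₁ E L q₀ q₁) := by
    rw [one_smul]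
    exact (h1.mdifferentiable (by simp) q₀).hasMFDerivAt
  exact (congrArg (fun T : EG →L[ℝ] ℝ => T ξ)
    (h2.comp (1 : G) (hasMFDerivAt_orbitMap (EG := EG) q₀ (1 : G))).mfderiv).symm

/-- The derivative of `g ↦ L(g • q₀, q₁)` at the fixed point `1` depends smoothly on `(q₀, q₁)`. The
coordinate changes in the general statement on derivatives of families are trivial here, as the base
point is constant and the target is a vector space. -/
theorem contMDiff_orbitDerivative [LieGroup 𝓘(ℝ, EG) ∞ G] [IsManifold 𝓘(ℝ, E) ∞ Q] :
    ContMDiff (𝓘(ℝ, E).prod 𝓘(ℝ, E)) 𝓘(ℝ, EG →L[ℝ] ℝ) ∞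
      (fun p : Q × Q => orbitDerivative EG G L p.1 p.2) := by
  have : IsManifold 𝓘(ℝ, EG) 1 G := IsManifold.of_le (n := ∞) (by simp)
  have : IsManifold 𝓘(ℝ, E) 1 Q := IsManifold.of_le (n := ∞) (by simp)
  intro p₀
  have hact : ContMDiff (𝓘(ℝ, EG).prod 𝓘(ℝ, E)) 𝓘(ℝ, E) ∞ (fun z : G × Q => z.1 • z.2) :=
    ContMDiffSMul.contMDiff_smul
  have hf : ContMDiff ((𝓘(ℝ, E).prod 𝓘(ℝ, E)).prod 𝓘(ℝ, EG)) 𝓘(ℝ, ℝ) ∞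
      (Function.uncurry (fun (p : Q × Q) (g : G) => L (g • p.1, p.2))) :=
    hL.comp ((hact.comp (contMDiff_snd.prodMk (contMDiff_fst.comp contMDiff_fst))).prodMk
      (contMDiff_snd.comp contMDiff_fst))
  have h := ContMDiffAt.mfderiv (m := ∞) (x₀ := p₀) (fun (p : Q × Q) (g : G) => L (g • p.1, p.2))
    (fun _ => (1 : G)) hf.contMDiffAt contMDiffAt_const (by simp)
  refine h.congr_of_eventuallyEq (Filter.Eventually.of_forall fun p => ?_)
  have h1 := inTangentCoordinates_eq (I := 𝓘(ℝ, EG)) (I' := 𝓘(ℝ, ℝ)) (x₀ := p₀) (x := p)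
    (fun _ : Q × Q => (1 : G)) (fun p => L ((1 : G) • p.1, p.2))
    (fun p => orbitDerivative EG G L p.1 p.2) (mem_chart_source EG 1)
    (by rw [chartAt_self_eq]; trivial)
  refine Eq.trans ?_ h1.symm
  ext ξ
  have h2 := (tangentBundleCore 𝓘(ℝ, EG) G).coordChange_self (achart EG (1 : G)) 1
    (mem_chart_source EG (1 : G)) ξ
  simp only [ContinuousLinearMap.comp_apply, tangentBundleCore_coordChange_model_space,
    ContinuousLinearMap.id_apply]
  exact congrArg (orbitDerivative EG G L p.1 p.2) h2.symm

/-- The form `D₂D₁L`, with an infinitesimal generator in its first slot, is the derivative of the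
momentum map in the second variable, up to sign. -/
theorem D₂D₁_infinitesimalGenerator [LieGroup 𝓘(ℝ, EG) ∞ G] [IsManifold 𝓘(ℝ, E) ∞ Q] (q₀ q₁ : Q)
    (ξ : EG) (w : E) :
    D₂D₁ E L q₀ q₁ (infinitesimalGenerator EG G E q₀ ξ) w =
      orbitDerivative₂ EG G E L q₀ q₁ w ξ := by
  have h1 : ContMDiff 𝓘(ℝ, E) 𝓘(ℝ, EG →L[ℝ] ℝ) ∞ (fun y : Q => orbitDerivative EG G L q₀ y) :=
    (contMDiff_orbitDerivative (EG := EG) (G := G) hL).comp (contMDiff_const.prodMk contMDiff_id)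
  have h2 := ((ContinuousLinearMap.apply ℝ ℝ ξ).hasMFDerivAt
    (x := orbitDerivative EG G L q₀ q₁)).comp q₁ (h1.mdifferentiable (by simp) q₁).hasMFDerivAt
  have e : (fun y : Q => D₁ E L q₀ y (infinitesimalGenerator EG G E q₀ ξ)) =
      (ContinuousLinearMap.apply ℝ ℝ ξ) ∘ (fun y : Q => orbitDerivative EG G L q₀ y) := by
    ext y
    exact D₁_infinitesimalGenerator hL q₀ y ξ
  unfold D₂D₁
  rw [e]
  exact congrArg (fun T : E →L[ℝ] ℝ => T w) h2.mfderiv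

variable [LieGroup 𝓘(ℝ, EG) ∞ G] 

theorem momentumMap_eq_iff {H : Subgroup G} {μ : GroupLieAlgebra 𝓘(ℝ, EG) G →L[ℝ] ℝ} {q₀ q₁ : Q} :
    momentumMap EG E H L q₀ q₁ = μ.comp (subgroupLieAlgebra EG H).subtypeL ↔
      ∀ ξ ∈ subgroupLieAlgebra EG H, orbitDerivative EG G L q₀ q₁ ξ = -μ ξ := by
  have key : ∀ ξ : subgroupLieAlgebra EG H, momentumMap EG E H L q₀ q₁ ξ =
      -orbitDerivative EG G L q₀ q₁ ξ.1 := fun ξ =>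
    congrArg (fun t : ℝ => -t) (D₁_infinitesimalGenerator (EG := EG) (G := G) hL q₀ q₁ ξ.1)
  constructor
  · intro h ξ hξ
    have h1 := DFunLike.congr_fun h ⟨ξ, hξ⟩
    rw [key] at h1
    exact neg_eq_iff_eq_neg.1 h1
  · intro h
    ext ξ
    rw [key]
    exact neg_eq_iff_eq_neg.2 (h ξ.1 ξ.2)

omit hL
theorem Ad_mem_subgroupLieAlgebra {H : Subgroup G} {h : G} (hh : h ∈ H)
    {ξ : GroupLieAlgebra 𝓘(ℝ, EG) G} (hξ : ξ ∈ subgroupLieAlgebra EG H) :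
    Ad EG h ξ ∈ subgroupLieAlgebra EG H := by
  obtain ⟨c, hc, hc0, hcH, rfl⟩ := hξ
  refine ⟨fun t => h * c t * h⁻¹, (contMDiff_const.mul hc).mul contMDiff_const, by simp [hc0],
    fun t => H.mul_mem (H.mul_mem hh (hcH t)) (H.inv_mem hh), ?_⟩
  have h1 : HasMFDerivAt 𝓘(ℝ, EG) 𝓘(ℝ, EG) (fun x : G => h * x * h⁻¹) (c 0) (Ad EG h) := by
    rw [hc0]
    exact (mdifferentiable_conj h 1).hasMFDerivAt
  exact congrArg (fun T : ℝ →L[ℝ] EG => T 1)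
    (h1.comp (0 : ℝ) (hc.mdifferentiable (by simp) 0).hasMFDerivAt).mfderiv

include hL
/-- Equivariance of the momentum map under a symmetry `h` of `L`: conjugation by `h⁻¹` turns the
orbit map of `h • q₀` into that of `q₀`. -/
theorem orbitDerivative_smul {h : G} (hinv : ∀ q₀ q₁ : Q, L (h⁻¹ • q₀, h⁻¹ • q₁) = L (q₀, q₁))
    (q₀ q₁ : Q) (ξ : GroupLieAlgebra 𝓘(ℝ, EG) G) :
    orbitDerivative EG G L (h • q₀) (h • q₁) ξ = orbitDerivative EG G L q₀ q₁ (Ad EG h⁻¹ ξ) := by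
  have e : (fun g : G => L (g • h • q₀, h • q₁)) =
      (fun g : G => L (g • q₀, q₁)) ∘ (fun x : G => h⁻¹ * x * h⁻¹⁻¹) := by
    ext g
    rw [← hinv]
    simp [mul_smul]
  have h1 : ContMDiff 𝓘(ℝ, EG) 𝓘(ℝ, ℝ) ∞ (fun g : G => L (g • q₀, q₁)) :=
    hL.comp ((contMDiff_orbitMap q₀).prodMk contMDiff_const)
  have h2 : HasMFDerivAt 𝓘(ℝ, EG) 𝓘(ℝ, ℝ) (fun g : G => L (g • q₀, q₁)) (h⁻¹ * 1 * h⁻¹⁻¹)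
      (orbitDerivative EG G L q₀ q₁) := by
    rw [show h⁻¹ * 1 * h⁻¹⁻¹ = 1 by simp]
    exact (h1.mdifferentiable (by simp) 1).hasMFDerivAt
  have h3 := (h2.comp (1 : G) (mdifferentiable_conj h⁻¹ 1).hasMFDerivAt).mfderiv
  unfold orbitDerivative
  rw [e]
  exact congrArg (fun T : EG →L[ℝ] ℝ => T ξ) h3

end Momentum

/-! ### Smooth structures pulled back along open embeddings -/

section Pullback

variable {S N E' : Type*} [TopologicalSpace S] [TopologicalSpace N] [TopologicalSpace E']
  {j : S → N} (hj : Topology.IsOpenEmbedding j) (c : N → OpenPartialHomeomorph N E')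

/-- The chart around `s` obtained from the chart `c (j s)` through the open embedding `j`. -/
noncomputable def pullbackChart (s : S) : OpenPartialHomeomorph S E' :=
  haveI : Nonempty S := ⟨s⟩
  (hj.toOpenPartialHomeomorph j).trans (c (j s))

theorem mem_pullbackChart_source {s x : S} :
    x ∈ (pullbackChart hj c s).source ↔ j x ∈ (c (j s)).source := by
  simp [pullbackChart]

theorem apply_pullbackChart_symm {s : S} {y : E'} (hy : y ∈ (pullbackChart hj c s).target) :
    y ∈ (c (j s)).target ∧ j ((pullbackChart hj c s).symm y) = (c (j s)).symm y := by
  have : Nonempty S := ⟨s⟩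
  simp only [pullbackChart, OpenPartialHomeomorph.trans_target, Set.mem_inter_iff] at hy
  exact ⟨hy.1, (hj.toOpenPartialHomeomorph j).right_inv hy.2⟩

/-- The charted space structure pulled back along an open embedding. -/
noncomputable abbrev pullbackChartedSpace (hc : ∀ n, n ∈ (c n).source) : ChartedSpace E' S where
  atlas := Set.range (pullbackChart hj c)
  chartAt := pullbackChart hj c
  mem_chart_source s := (mem_pullbackChart_source hj c).2 (hc (j s))
  chart_mem_atlas s := ⟨s, rfl⟩

end Pullback

section PullbackSmooth

variable {S N E' : Type*} [TopologicalSpace S] [TopologicalSpace N]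
  [NormedAddCommGroup E'] [NormedSpace ℝ E']
  {j : S → N} (hj : Topology.IsOpenEmbedding j) {c : N → OpenPartialHomeomorph N E'}
  {EN HN : Type*} [NormedAddCommGroup EN] [NormedSpace ℝ EN] [TopologicalSpace HN]
  {IN : ModelWithCorners ℝ EN HN} [ChartedSpace HN N]
  (hc : ∀ n, n ∈ (c n).source) (hcs : ∀ n, ContMDiffOn IN 𝓘(ℝ, E') ∞ (c n) (c n).source)
  (hcs' : ∀ n, ContMDiffOn 𝓘(ℝ, E') IN ∞ (c n).symm (c n).target)

include hcs hcs' in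
theorem isManifold_pullbackChartedSpace :
    letI := pullbackChartedSpace hj c hc
    IsManifold 𝓘(ℝ, E') ∞ S := by
  let := pullbackChartedSpace hj c hc
  refine isManifold_of_contDiffOn _ _ _ ?_
  rintro _ _ ⟨s, rfl⟩ ⟨s', rfl⟩
  rw [← contMDiffOn_iff_contDiffOn]
  have key : ∀ y ∈ ((pullbackChart hj c s).symm.trans (pullbackChart hj c s')).source,
      y ∈ (c (j s)).target ∧ (c (j s)).symm y ∈ (c (j s')).source ∧
      (pullbackChart hj c s).symm.trans (pullbackChart hj c s') y =
        c (j s') ((c (j s)).symm y) := by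
    rintro y ⟨hy, hy'⟩
    obtain ⟨h1, h2⟩ := apply_pullbackChart_symm hj c hy
    refine ⟨h1, ?_, ?_⟩
    · rw [← h2]
      exact (mem_pullbackChart_source hj c).1 hy'
    · rw [← h2]
      rfl
  refine ContMDiffOn.congr (f := c (j s') ∘ (c (j s)).symm) ?_ ?_
  · exact (hcs (j s')).comp ((hcs' (j s)).mono fun y hy => (key y hy.1).1) fun y hy =>
      (key y hy.1).2.1
  · exact fun y hy => (key y hy.1).2.2

include hcs hcs' in
theorem isLocalDiffeomorph_of_pullbackChartedSpace :
    letI := pullbackChartedSpace hj c hc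
    IsLocalDiffeomorph 𝓘(ℝ, E') IN ∞ j := by
  let := pullbackChartedSpace hj c hc
  have : IsManifold 𝓘(ℝ, E') ∞ S := isManifold_pullbackChartedSpace hj hc hcs hcs'
  have hmem : ∀ s, pullbackChart hj c s ∈ IsManifold.maximalAtlas 𝓘(ℝ, E') ∞ S :=
    fun s => IsManifold.chart_mem_maximalAtlas s
  have hsmooth : ContMDiff 𝓘(ℝ, E') IN ∞ j := by
    intro s
    have hs : s ∈ (pullbackChart hj c s).source := (mem_pullbackChart_source hj c).2 (hc _)
    have hs' := (pullbackChart hj c s).map_source hs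
    refine (((hcs' (j s)).contMDiffAt ((c (j s)).open_target.mem_nhds
      (apply_pullbackChart_symm hj c hs').1)).comp s
      (contMDiffAt_of_mem_maximalAtlas (hmem s) hs)).congr_of_eventuallyEq ?_
    filter_upwards [(pullbackChart hj c s).open_source.mem_nhds hs] with x hx
    exact ((c (j s)).left_inv ((mem_pullbackChart_source hj c).1 hx)).symm
  intro s₀
  have : Nonempty S := ⟨s₀⟩
  let jo := hj.toOpenPartialHomeomorph j
  have hjo : ∀ s, jo.symm (j s) = s := fun s => jo.left_inv (x := s) trivial
  refine ⟨{ toPartialEquiv := jo.toPartialEquiv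
            open_source := jo.open_source
            open_target := jo.open_target
            contMDiffOn_toFun := hsmooth.contMDiffOn
            contMDiffOn_invFun := ?_ }, trivial, fun _ _ => rfl⟩
  intro n hn
  have hn' : n ∈ Set.range j := by simpa [jo] using hn
  obtain ⟨s, rfl⟩ := hn'
  refine ContMDiffAt.contMDiffWithinAt ?_
  have hs : s ∈ (pullbackChart hj c s).source := (mem_pullbackChart_source hj c).2 (hc _)
  have h1 : ContMDiffAt 𝓘(ℝ, E') 𝓘(ℝ, E') ∞ (pullbackChart hj c s).symm (c (j s) (j s)) :=
    contMDiffAt_symm_of_mem_maximalAtlas (hmem s) ((pullbackChart hj c s).map_source hs)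
  refine (h1.comp (j s) ((hcs (j s)).contMDiffAt
    ((c (j s)).open_source.mem_nhds (hc _)))).congr_of_eventuallyEq ?_
  filter_upwards [hj.isOpen_range.mem_nhds ⟨s, rfl⟩,
    (c (j s)).open_source.mem_nhds (hc (j s))] with n hn hnc
  obtain ⟨x, rfl⟩ := hn
  exact (hjo x).trans ((pullbackChart hj c s).left_inv
    ((mem_pullbackChart_source hj c).2 hnc)).symm

end PullbackSmooth

/-! ### Level sets -/

section LevelSet

/-- A chart around `n` with values in a normed space `E'` isomorphic to the model space. -/
theorem exists_chart_into_model {EN HN N E' : Type*} [NormedAddCommGroup EN] [NormedSpace ℝ EN]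
    [TopologicalSpace HN] {IN : ModelWithCorners ℝ EN HN} [IN.Boundaryless]
    [TopologicalSpace N] [ChartedSpace HN N] [IsManifold IN ∞ N]
    [NormedAddCommGroup E'] [NormedSpace ℝ E'] (A : EN ≃L[ℝ] E') (n : N) :
    ∃ c : OpenPartialHomeomorph N E', n ∈ c.source ∧ ContMDiffOn IN 𝓘(ℝ, E') ∞ c c.source ∧
      ContMDiffOn 𝓘(ℝ, E') IN ∞ c.symm c.target := by
  refine ⟨(chartAt HN n).trans
    (IN.toHomeomorph.trans A.toHomeomorph).toOpenPartialHomeomorph, by simp, ?_, ?_⟩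
  · refine A.contDiff.contMDiff.comp_contMDiffOn (IN.contMDiff.comp_contMDiffOn
      (contMDiffOn_chart.mono ?_))
    simp
  · have h1 : ContMDiff 𝓘(ℝ, EN) IN ∞ IN.symm := by
      rw [← contMDiffOn_univ, ← IN.range_eq_univ]
      exact IN.contMDiffOn_symm
    refine contMDiffOn_chart_symm.comp (h1.comp A.symm.contDiff.contMDiff).contMDiffOn ?_
    intro y hy
    simpa using hy

variable {EM HM M : Type*} [NormedAddCommGroup EM] [NormedSpace ℝ EM] [TopologicalSpace HM]
  {IM : ModelWithCorners ℝ EM HM} [TopologicalSpace M] [ChartedSpace HM M]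
  {EN HN N : Type*} [NormedAddCommGroup EN] [NormedSpace ℝ EN] [TopologicalSpace HN]
  {IN : ModelWithCorners ℝ EN HN} [TopologicalSpace N] [ChartedSpace HN N]
  {F : Type*} [NormedAddCommGroup F] [NormedSpace ℝ F]
  {f : M → N} {J : M → F} {S : Set M}
  (hS : ∀ p, p ∈ S ↔ J p = 0)
  (hΦ : ∀ p ∈ S, IsLocalDiffeomorphAt IM (IN.prod 𝓘(ℝ, F)) ∞ (fun p => (f p, J p)) p)

include hS hΦ

/-- Near `f p`, the map `f` has a smooth local section with values in the level set. -/
theorem exists_local_section {p : M} (hp : p ∈ S) :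
    ∃ σ : N → M, ContMDiffAt IN IM ∞ σ (f p) ∧ σ (f p) = p ∧
      ∀ᶠ n in 𝓝 (f p), σ n ∈ S ∧ f (σ n) = n := by
  have h := hΦ p hp
  have hJ : J p = 0 := (hS p).1 hp
  have hι : ContMDiff IN (IN.prod 𝓘(ℝ, F)) ∞ (fun n : N => (n, (0 : F))) :=
    contMDiff_id.prodMk contMDiff_const
  have e0 : (f p, J p) = (f p, 0) := by rw [hJ]
  have h1 := h.localInverse_contMDiffAt
  rw [e0] at h1
  have h2 := h.localInverse_eventuallyEq_right
  rw [e0] at h2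
  refine ⟨fun n => h.localInverse (n, 0), h1.comp (f p) hι.contMDiffAt, ?_, ?_⟩
  · have := h.localInverse_left_inv h.localInverse_mem_target
    rwa [e0] at this
  · filter_upwards [hι.continuous.continuousAt.eventually h2] with n hn
    obtain ⟨h3, h4⟩ := Prod.mk.inj hn
    exact ⟨(hS _).2 h4, h3⟩

/-- A map into the level set is smooth as soon as its composition with `f` is. -/
theorem contMDiffAt_of_comp (hinj : Set.InjOn f S)
    {EX HX X : Type*} [NormedAddCommGroup EX] [NormedSpace ℝ EX] [TopologicalSpace HX]
    {IX : ModelWithCorners ℝ EX HX} [TopologicalSpace X] [ChartedSpace HX X]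
    {s : X → M} (hs : ∀ x, s x ∈ S) {x : X} (hfs : ContMDiffAt IX IN ∞ (f ∘ s) x) :
    ContMDiffAt IX IM ∞ s x := by
  obtain ⟨σ, hσ, -, hσS⟩ := exists_local_section hS hΦ (hs x)
  refine (hσ.comp x hfs).congr_of_eventuallyEq ?_
  filter_upwards [hfs.continuousAt.eventually hσS] with y hy
  exact hinj (hs y) hy.1 hy.2.symm

theorem isOpenEmbedding_levelSet (hinj : Set.InjOn f S) :
    Topology.IsOpenEmbedding (fun p : S => f p) := by
  refine .of_continuous_injective_isOpenMap ?_ ?_ ?_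
  · rw [continuous_iff_continuousAt]
    intro p
    exact ((hΦ p p.2).contMDiffAt.continuousAt.fst).comp continuousAt_subtype_val
  · intro p p' h
    exact Subtype.ext (hinj p.2 p'.2 h)
  · rw [isOpenMap_iff_nhds_le]
    intro p t ht
    obtain ⟨V, hV, hVt⟩ := mem_nhds_subtype _ _ _ |>.1 ht
    obtain ⟨σ, hσ, hσp, hσS⟩ := exists_local_section hS hΦ p.2
    have h1 : ∀ᶠ n in 𝓝 (f p), σ n ∈ V := hσ.continuousAt.eventually (by rwa [hσp])
    filter_upwards [h1, hσS] with n hn hn'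
    have h2 := @hVt ⟨σ n, hn'.1⟩ hn
    rwa [Set.mem_preimage, hn'.2] at h2

/-- A level set `S = J⁻¹(0)` at whose points `(f, J)` is a local diffeomorphism, with `f`
injective on `S`, is an embedded submanifold on which `f` is a local diffeomorphism. -/
theorem exists_chartedSpace_levelSet [IM.Boundaryless] [IN.Boundaryless] [IsManifold IM ∞ M]
    [IsManifold IN ∞ N] (hinj : Set.InjOn f S)
    {E' : Type*} [NormedAddCommGroup E'] [NormedSpace ℝ E'] (A : EN ≃L[ℝ] E') :
    ∃ _ : ChartedSpace E' S, IsManifold 𝓘(ℝ, E') ∞ S ∧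
      Manifold.IsSmoothEmbedding 𝓘(ℝ, E') IM ∞ (Subtype.val : S → M) ∧
      IsLocalDiffeomorph 𝓘(ℝ, E') IN ∞ (fun p : S => f p) := by
  choose c hc hcs hcs' using fun n : N => exists_chart_into_model (IN := IN) A n
  have hj := isOpenEmbedding_levelSet hS hΦ hinj
  let := pullbackChartedSpace hj c hc
  have : IsManifold 𝓘(ℝ, E') ∞ S := isManifold_pullbackChartedSpace hj hc hcs hcs'
  refine ⟨inferInstance, this, ⟨?_, .subtypeVal⟩,
    isLocalDiffeomorph_of_pullbackChartedSpace hj hc hcs hcs'⟩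
  refine Manifold.IsImmersionOfComplement.isImmersion (F := F) fun s => ?_
  -- the source chart is a chart of `f`, the target chart is the same chart of `f` paired with `J`
  let n := f s
  obtain ⟨Φ, hsΦ, hΦeq⟩ := hΦ s s.2
  -- the derivative at `s` serves as the linear identification of the model spaces
  let B : (E' × F) ≃L[ℝ] EM :=
    (A.symm.prodCongr (ContinuousLinearEquiv.refl ℝ F)).trans
      ((hΦ s s.2).mfderivToContinuousLinearEquiv (by simp)).symm
  let d : OpenPartialHomeomorph M (E' × F) :=
    Φ.toOpenPartialHomeomorph.trans ((c n).prod (OpenPartialHomeomorph.refl F))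
  have hd : ∀ x ∈ d.source, x ∈ Φ.source ∧ f x ∈ (c n).source ∧ d x = (c n (f x), J x) := by
    rintro x ⟨hx, hx'⟩
    have h1 : Φ.toOpenPartialHomeomorph x = (f x, J x) := (hΦeq hx).symm
    change Φ.toOpenPartialHomeomorph x ∈ ((c n).prod (OpenPartialHomeomorph.refl F)).source at hx'
    rw [h1] at hx'
    refine ⟨hx, hx'.1, ?_⟩
    change (c n (Φ.toOpenPartialHomeomorph x).1, (Φ.toOpenPartialHomeomorph x).2) = _
    rw [h1]
  have hd_smooth : ContMDiffOn IM 𝓘(ℝ, E' × F) ∞ d d.source := by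
    have h1 : ContMDiffOn IM (IN.prod 𝓘(ℝ, F)) ∞ (fun x => (f x, J x)) d.source :=
      (Φ.contMDiffOn_toFun.congr hΦeq).mono fun x hx => (hd x hx).1
    have h2 : ContMDiffOn IM 𝓘(ℝ, E' × F) ∞ (fun x => (c n (f x), J x)) d.source :=
      ((hcs n).comp (contMDiff_fst.comp_contMDiffOn h1) fun x hx => (hd x hx).2.1).prodMk_space
        (contMDiff_snd.comp_contMDiffOn h1)
    exact h2.congr fun x hx => (hd x hx).2.2
  have hd_symm : ContMDiffOn 𝓘(ℝ, E' × F) IM ∞ d.symm d.target := by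
    have h1 : ContMDiffOn 𝓘(ℝ, E' × F) (IN.prod 𝓘(ℝ, F)) ∞
        (fun y : E' × F => ((c n).symm y.1, y.2)) d.target :=
      ((hcs' n).comp contDiff_fst.contMDiff.contMDiffOn fun y hy => hy.1.1).prodMk
        contDiff_snd.contMDiff.contMDiffOn
    exact Φ.contMDiffOn_invFun.comp h1 fun y hy => hy.2
  let h : E' × F ≃ₜ HM := B.toHomeomorph.trans IM.toHomeomorph.symm
  have hh : ContMDiff 𝓘(ℝ, E' × F) IM ∞ h := by
    have h1 : ContMDiff 𝓘(ℝ, EM) IM ∞ IM.symm := by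
      rw [← contMDiffOn_univ, ← IM.range_eq_univ]
      exact IM.contMDiffOn_symm
    exact h1.comp B.contDiff.contMDiff
  have hh' : ContMDiff IM 𝓘(ℝ, E' × F) ∞ h.symm :=
    B.symm.contDiff.contMDiff.comp IM.contMDiff
  have hsd : (s : M) ∈ d.source := by
    refine ⟨hsΦ, ?_⟩
    have h1 : Φ.toOpenPartialHomeomorph s = (f s, J s) := (hΦeq hsΦ).symm
    change Φ.toOpenPartialHomeomorph s ∈ ((c n).prod (OpenPartialHomeomorph.refl F)).source
    rw [h1]
    exact ⟨hc n, trivial⟩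
  refine Manifold.IsImmersionAtOfComplement.mk_of_charts B
    ((pullbackChart hj c s).restrOpen (Subtype.val ⁻¹' d.source)
      (d.open_source.preimage continuous_subtype_val))
    (d.trans h.toOpenPartialHomeomorph) ?_ ?_ ?_ ?_ ?_ ?_
  · exact ⟨(mem_pullbackChart_source hj c).2 (hc _), hsd⟩
  · simpa using hsd
  · have hmem : pullbackChart hj c s ∈ IsManifold.maximalAtlas 𝓘(ℝ, E') ∞ S :=
      IsManifold.chart_mem_maximalAtlas s
    refine OpenPartialHomeomorph.mem_maximalAtlas_of_contMDiffOn _ ?_ ?_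
    · exact (contMDiffOn_of_mem_maximalAtlas hmem).mono fun x hx => hx.1
    · exact (contMDiffOn_symm_of_mem_maximalAtlas hmem).mono fun x hx => hx.1
  · refine OpenPartialHomeomorph.mem_maximalAtlas_of_contMDiffOn _ ?_ ?_
    · exact hh.comp_contMDiffOn (hd_smooth.mono fun x hx => hx.1)
    · exact hd_symm.comp hh'.contMDiffOn fun y hy => hy.2
  · intro x hx
    simpa using hx.2
  · intro y hy
    have hy' : y ∈ ((pullbackChart hj c s).restrOpen (Subtype.val ⁻¹' d.source)
      (d.open_source.preimage continuous_subtype_val)).target := by simpa using hy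
    let x : S := (pullbackChart hj c s).symm y
    have hyt : y ∈ (pullbackChart hj c s).target := hy'.1
    have hx : (x : M) ∈ d.source :=
      (((pullbackChart hj c s).restrOpen (Subtype.val ⁻¹' d.source)
        (d.open_source.preimage continuous_subtype_val)).map_target hy').2
    have h1 : d x = (y, 0) := by
      rw [(hd x hx).2.2, (hS x).1 x.2]
      exact congrArg (·, (0 : F)) ((pullbackChart hj c s).right_inv hyt)
    change IM (IM.toHomeomorph.symm (B (d x))) = B (y, 0)
    rw [h1]
    exact IM.toHomeomorph.apply_symm_apply _

end LevelSet

/-! ### Transversality of the momentum level to the orbits -/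

section Transversality

/-- The linear algebra of transversality. Here `P` is the derivative of the projection to the
orbit space, `A` is the infinitesimal generator map, which sends `W` onto the kernel of `P`, and
`K` is the derivative of the momentum in the second variable, which is nondegenerate on that
kernel. -/
theorem bijective_of_nondegenerate {EG E EB : Type*} [NormedAddCommGroup EG] [NormedSpace ℝ EG]
    [FiniteDimensional ℝ EG] [NormedAddCommGroup E] [NormedSpace ℝ E] [NormedAddCommGroup EB]
    [NormedSpace ℝ EB] {W : Submodule ℝ EG} {P : E →L[ℝ] EB} {A : EG →L[ℝ] E}
    {K : E →L[ℝ] EG →L[ℝ] ℝ} (R : E →L[ℝ] W →L[ℝ] ℝ)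
    (hP : Function.Surjective P) (hA : Function.Injective A) (hPA : ∀ ξ ∈ W, P (A ξ) = 0)
    (hker : ∀ w, P w = 0 → ∃ ξ ∈ W, A ξ = w)
    (hK : ∀ η ∈ W, (∀ ξ ∈ W, K (A η) ξ = 0) → A η = 0) :
    Function.Bijective
      (fun z : E × E => ((z.1, P z.2), R z.1 + (K z.2).comp W.subtypeL)) := by
  constructor
  · rintro ⟨v, w⟩ ⟨v', w'⟩ h
    simp only [Prod.mk.injEq] at h
    obtain ⟨⟨rfl, h1⟩, h2⟩ := h
    obtain ⟨η, hη, hηw⟩ := hker (w - w') (by rw [map_sub, h1, sub_self])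
    have h3 : A η = 0 := by
      refine hK η hη fun ξ hξ => ?_
      have h4 : (K w) ξ = (K w') ξ := DFunLike.congr_fun (add_left_cancel h2) ⟨ξ, hξ⟩
      rw [hηw, map_sub, sub_apply, h4, sub_self]
    rw [h3] at hηw
    rw [sub_eq_zero.1 hηw.symm]
  · -- `W` and its dual have the same dimension, so that the injective map `W → W*` is onto
    let T : W →ₗ[ℝ] (W →L[ℝ] ℝ) :=
      { toFun := fun η => (K (A η)).comp W.subtypeL
        map_add' := fun η η' => by ext; simp
        map_smul' := fun r η => by ext; simp }
    have hT : Function.Injective T := by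
      rw [injective_iff_map_eq_zero]
      intro η h
      have h1 : A η = 0 := hK η η.2 fun ξ hξ => DFunLike.congr_fun h ⟨ξ, hξ⟩
      exact Subtype.ext (hA (h1.trans (map_zero A).symm))
    have hdim : Module.finrank ℝ W = Module.finrank ℝ (W →L[ℝ] ℝ) := by
      rw [← (LinearMap.toContinuousLinearMap : (W →ₗ[ℝ] ℝ) ≃ₗ[ℝ] W →L[ℝ] ℝ).finrank_eq]
      exact (Subspace.dual_finrank_eq (K := ℝ) (V := W)).symm
    have hTs : Function.Surjective T :=
      (LinearMap.injective_iff_surjective_of_finrank_eq_finrank hdim).1 hT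
    rintro ⟨⟨v, u⟩, l⟩
    obtain ⟨w, rfl⟩ := hP u
    obtain ⟨η, hη⟩ := hTs (l - R v - (K w).comp W.subtypeL)
    refine ⟨(v, w + A η), ?_⟩
    have h1 : (K (A η)).comp W.subtypeL = l - R v - (K w).comp W.subtypeL := hη
    simp only [map_add, hPA η η.2, add_zero, ContinuousLinearMap.add_comp, h1]
    rw [Prod.mk.injEq]
    exact ⟨rfl, by abel⟩

variable {EG : Type*} [NormedAddCommGroup EG] [NormedSpace ℝ EG]
  {G : Type*} [TopologicalSpace G] [ChartedSpace EG G] [Group G] [LieGroup 𝓘(ℝ, EG) ∞ G]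
  {E : Type*} [NormedAddCommGroup E] [NormedSpace ℝ E]
  {Q : Type*} [TopologicalSpace Q] [ChartedSpace E Q]
  [MulAction G Q]

/-- The Lie algebra of `H` as a subspace of the model space of `G`, which carries a norm. -/
noncomputable def modelLieAlgebra (EG : Type*) [NormedAddCommGroup EG] [NormedSpace ℝ EG]
    {G : Type*} [TopologicalSpace G] [ChartedSpace EG G] [Group G] [LieGroup 𝓘(ℝ, EG) ∞ G]
    (H : Subgroup G) : Submodule ℝ EG :=
  subgroupLieAlgebra EG H

/-- The difference `μ - J`, as a function with values in the dual of the Lie algebra of `H`; its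
zero set is the level `J = μ` of the discrete momentum map. -/
noncomputable def momentumDefect (H : Subgroup G) (μ : EG →L[ℝ] ℝ) (L : Q × Q → ℝ) (p : Q × Q) :
    modelLieAlgebra EG H →L[ℝ] ℝ :=
  (orbitDerivative EG G L p.1 p.2 + μ).comp (modelLieAlgebra EG H).subtypeL

variable [ContMDiffSMul 𝓘(ℝ, EG) 𝓘(ℝ, E) ∞ G Q]
  {L : Q × Q → ℝ} (hL : ContMDiff (𝓘(ℝ, E).prod 𝓘(ℝ, E)) 𝓘(ℝ, ℝ) ∞ L)

include hL

theorem momentumDefect_eq_zero_iff {H : Subgroup G} {μ : GroupLieAlgebra 𝓘(ℝ, EG) G →L[ℝ] ℝ}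
    {p : Q × Q} : momentumMap EG E H L p.1 p.2 = μ.comp (subgroupLieAlgebra EG H).subtypeL ↔
      momentumDefect (EG := EG) H μ L p = 0 := by
  rw [momentumMap_eq_iff hL]
  constructor
  · intro h
    ext ξ
    exact eq_neg_iff_add_eq_zero.1 (h ξ.1 ξ.2)
  · intro h ξ hξ
    exact eq_neg_iff_add_eq_zero.2 (DFunLike.congr_fun h ⟨ξ, hξ⟩)

variable [IsManifold 𝓘(ℝ, E) ∞ Q]

theorem contMDiff_momentumDefect (H : Subgroup G) (μ : EG →L[ℝ] ℝ) :
    ContMDiff (𝓘(ℝ, E).prod 𝓘(ℝ, E)) 𝓘(ℝ, modelLieAlgebra EG H →L[ℝ] ℝ) ∞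
      (momentumDefect H μ L) := by
  have h1 : ContDiff ℝ ∞ (fun T : EG →L[ℝ] ℝ => (T + μ).comp (modelLieAlgebra EG H).subtypeL) :=
    (contDiff_id.add contDiff_const).clm_comp contDiff_const
  exact h1.contMDiff.comp (contMDiff_orbitDerivative hL)

theorem mfderiv_momentumDefect_snd (H : Subgroup G) (μ : EG →L[ℝ] ℝ) (q₀ q₁ : Q) (w : E) :
    (mfderiv 𝓘(ℝ, E) 𝓘(ℝ, modelLieAlgebra EG H →L[ℝ] ℝ)
      (fun y => momentumDefect H μ L (q₀, y)) q₁ : E →L[ℝ] modelLieAlgebra EG H →L[ℝ] ℝ) w =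
      (orbitDerivative₂ EG G E L q₀ q₁ w).comp (modelLieAlgebra EG H).subtypeL := by
  have h1 : ContMDiff 𝓘(ℝ, E) 𝓘(ℝ, EG →L[ℝ] ℝ) ∞ (fun y : Q => orbitDerivative EG G L q₀ y) :=
    (contMDiff_orbitDerivative (EG := EG) (G := G) hL).comp (contMDiff_const.prodMk contMDiff_id)
  let C : (EG →L[ℝ] ℝ) →L[ℝ] (modelLieAlgebra EG H →L[ℝ] ℝ) :=
    (ContinuousLinearMap.compL ℝ (modelLieAlgebra EG H) EG ℝ).flip (modelLieAlgebra EG H).subtypeL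
  have h2 : HasFDerivAt (fun T : EG →L[ℝ] ℝ => (T + μ).comp (modelLieAlgebra EG H).subtypeL) C
      (orbitDerivative EG G L q₀ q₁) := by
    have := C.hasFDerivAt (x := orbitDerivative EG G L q₀ q₁) |>.add_const (C μ)
    refine this.congr_of_eventuallyEq (Filter.Eventually.of_forall fun T => ?_)
    exact map_add C T μ
  have h3 := (HasFDerivAt.hasMFDerivAt (E := EG →L[ℝ] ℝ)
    (E' := modelLieAlgebra EG H →L[ℝ] ℝ) h2).comp q₁ (h1.mdifferentiable (by simp) q₁).hasMFDerivAt
  exact congrArg (fun T : E →L[ℝ] modelLieAlgebra EG H →L[ℝ] ℝ => T w) h3.mfderiv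

/-- If `L` is `H`-regular, the map `(q₀, q₁) ↦ (q₀, π(q₁), J(q₀, q₁))` is a local diffeomorphism:
the kernel of the derivative of `π` is the tangent space of the orbit, and the derivative of
`J(q₀, ·)` maps it isomorphically onto the dual of the Lie algebra. -/
theorem isLocalDiffeomorphAt_quotient_momentumDefect [FiniteDimensional ℝ EG]
    [FiniteDimensional ℝ E] [ProperSMul G Q] (hfree : ∀ (g : G) (q : Q), g • q = q → g = 1)
    {EB : Type*} [NormedAddCommGroup EB] [NormedSpace ℝ EB] {H : Subgroup G}
    [ChartedSpace EB (MulAction.orbitRel.Quotient H Q)]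
    [IsManifold 𝓘(ℝ, EB) ∞ (MulAction.orbitRel.Quotient H Q)]
    (hπ : Manifold.IsSubmersion 𝓘(ℝ, E) 𝓘(ℝ, EB) ∞
      (Quotient.mk _ : Q → MulAction.orbitRel.Quotient H Q))
    (hreg : IsSubgroupRegular EG E H L) (μ : EG →L[ℝ] ℝ) (p : Q × Q) :
    IsLocalDiffeomorphAt (𝓘(ℝ, E).prod 𝓘(ℝ, E))
      ((𝓘(ℝ, E).prod 𝓘(ℝ, EB)).prod 𝓘(ℝ, modelLieAlgebra EG H →L[ℝ] ℝ)) ∞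
      (fun p : Q × Q => ((p.1, (Quotient.mk _ p.2 : MulAction.orbitRel.Quotient H Q)),
        momentumDefect H μ L p)) p := by
  have hJ := contMDiff_momentumDefect (EG := EG) hL H μ
  have hf : ContMDiff (𝓘(ℝ, E).prod 𝓘(ℝ, E)) (𝓘(ℝ, E).prod 𝓘(ℝ, EB)) ∞
      (fun p : Q × Q => (p.1, (Quotient.mk _ p.2 : MulAction.orbitRel.Quotient H Q))) :=
    contMDiff_fst.prodMk (hπ.contMDiff.comp contMDiff_snd)
  refine isLocalDiffeomorphAt_of_bijective_mfderiv
    (Filter.Eventually.of_forall fun p => (hf.prodMk hJ).contMDiffAt) ?_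
  obtain ⟨q₀, q₁⟩ := p
  have hπ₁ := hπ.isSubmersionAt q₁
  let P : E →L[ℝ] EB := mfderiv 𝓘(ℝ, E) 𝓘(ℝ, EB)
    (Quotient.mk _ : Q → MulAction.orbitRel.Quotient H Q) q₁
  let A : EG →L[ℝ] E := infinitesimalGenerator EG G E q₁
  let K : E →L[ℝ] EG →L[ℝ] ℝ := orbitDerivative₂ EG G E L q₀ q₁
  let R : E →L[ℝ] modelLieAlgebra EG H →L[ℝ] ℝ :=
    mfderiv 𝓘(ℝ, E) 𝓘(ℝ, modelLieAlgebra EG H →L[ℝ] ℝ) (fun x => momentumDefect H μ L (x, q₁)) q₀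
  have hbij := bijective_of_nondegenerate (W := modelLieAlgebra EG H) (P := P) (A := A) (K := K) R
    (mfderiv_surjective_of_isSubmersionAt hπ₁)
    (infinitesimalGenerator_injective (EG := EG) (E := E) hfree q₁)
    (fun ξ hξ => mfderiv_quotient_eq_zero_of_mem_verticalSpace
      (hπ₁.contMDiffAt.mdifferentiableAt (by simp)) ⟨ξ, hξ, rfl⟩)
    (fun w hw => mem_verticalSpace_of_mfderiv_quotient_eq_zero hfree hπ₁ hw) ?_
  swap
  · intro η hη h
    refine (hreg q₀ q₁).2 (A η) ⟨η, hη, rfl⟩ ?_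
    rintro _ ⟨ξ, hξ, rfl⟩
    exact (D₂D₁_infinitesimalGenerator (EG := EG) (G := G) hL q₀ q₁ ξ (A η)).trans (h ξ hξ)
  have hfd : HasMFDerivAt (𝓘(ℝ, E).prod 𝓘(ℝ, E)) (𝓘(ℝ, E).prod 𝓘(ℝ, EB))
      (fun p : Q × Q => (p.1, (Quotient.mk _ p.2 : MulAction.orbitRel.Quotient H Q))) (q₀, q₁)
      ((ContinuousLinearMap.fst ℝ E E).prod (P.comp (ContinuousLinearMap.snd ℝ E E))) :=
    (hasMFDerivAt_fst (q₀, q₁)).prodMk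
      (HasMFDerivAt.comp (g := (Quotient.mk _ : Q → MulAction.orbitRel.Quotient H Q))
        (q₀, q₁) (hπ₁.contMDiffAt.mdifferentiableAt (by simp)).hasMFDerivAt
        (hasMFDerivAt_snd (q₀, q₁)))
  have hJd := hJ.mdifferentiable (by simp) (q₀, q₁)
  have hd := (hfd.prodMk hJd.hasMFDerivAt).mfderiv
  convert! hbij using 1
  ext z : 1
  refine (congrArg (fun T : E × E →L[ℝ] (E × EB) × (modelLieAlgebra EG H →L[ℝ] ℝ) => T z) hd).trans
    (Prod.ext rfl ?_)
  refine (mfderiv_prod_eq_add_apply (v := z) hJd).trans ?_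
  exact congrArg (R z.1 + ·) (mfderiv_momentumDefect_snd hL H μ q₀ q₁ z.2)

end Transversality

/-! ### The momentum level as an affine discrete connection -/

section Connection

variable {EG : Type*} [NormedAddCommGroup EG] [NormedSpace ℝ EG]
  {G : Type*} [TopologicalSpace G] [ChartedSpace EG G] [Group G] [LieGroup 𝓘(ℝ, EG) ∞ G]
  {E : Type*} [NormedAddCommGroup E] [NormedSpace ℝ E]
  {Q : Type*} [TopologicalSpace Q] [ChartedSpace E Q]
  [MulAction G Q]

/-- The level `J = μ` is invariant under the diagonal action of `G_μ`, because `J` is equivariant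
for the coadjoint action and `G_μ` fixes `μ`. -/
theorem smul_mem_momentumLevel [ContMDiffSMul 𝓘(ℝ, EG) 𝓘(ℝ, E) ∞ G Q]
    {L : Q × Q → ℝ} (hL : ContMDiff (𝓘(ℝ, E).prod 𝓘(ℝ, E)) 𝓘(ℝ, ℝ) ∞ L)
    {μ : GroupLieAlgebra 𝓘(ℝ, EG) G →L[ℝ] ℝ}
    (hinv : ∀ g ∈ coadjointIsotropy μ, ∀ q₀ q₁ : Q, L (g • q₀, g • q₁) = L (q₀, q₁))
    (h : coadjointIsotropy μ) {q₀ q₁ : Q} (hp : (q₀, q₁) ∈ momentumLevel E μ L) :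
    (h • q₀, h • q₁) ∈ momentumLevel E μ L := by
  refine (momentumMap_eq_iff hL).2 fun ξ hξ => ?_
  have h1 := (momentumMap_eq_iff hL).1 hp (Ad EG (h : G)⁻¹ ξ)
    (Ad_mem_subgroupLieAlgebra (inv_mem h.2) hξ)
  refine (orbitDerivative_smul hL (hinv _ (inv_mem h.2)) q₀ q₁ ξ).trans (h1.trans ?_)
  rw [h.2 ξ]

end Connection

section Domain

variable {G Q : Type*} [Group G] [MulAction G Q]

/-- The domain is the preimage under `id × π` of the image of `Hor` under `id × π`. -/
theorem mem_connectionDomain_iff {H : Subgroup G} {Hor : Set (Q × Q)} {p : Q × Q} :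
    p ∈ connectionDomain H Hor ↔ ∃ p' ∈ Hor,
      (p'.1, (Quotient.mk _ p'.2 : MulAction.orbitRel.Quotient H Q)) = (p.1, Quotient.mk _ p.2) := by
  constructor
  · rintro ⟨h, q₁, hp, hq⟩
    refine ⟨(p.1, q₁), hp, Prod.ext rfl (Quotient.sound ⟨h⁻¹, ?_⟩)⟩
    simp [hq]
  · rintro ⟨⟨q₀, q₁⟩, hp, he⟩
    obtain ⟨h1, h2⟩ := Prod.mk.inj he
    obtain ⟨h, hh⟩ := Quotient.exact h2.symm
    obtain rfl : q₀ = p.1 := h1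
    exact ⟨h, q₁, hp, hh.symm⟩

theorem smul_mem_connectionDomain {H : Subgroup G} {Hor : Set (Q × Q)}
    (hinv : ∀ (h : H) (q₀ q₁ : Q), (q₀, q₁) ∈ Hor → (h • q₀, h • q₁) ∈ Hor) (g₀ g₁ : H)
    {q₀ q₁ : Q} (hp : (q₀, q₁) ∈ connectionDomain H Hor) :
    (g₀ • q₀, g₁ • q₁) ∈ connectionDomain H Hor := by
  obtain ⟨h, q, hq, he⟩ := hp
  obtain rfl : q₁ = h • q := he
  refine ⟨g₁ * h * g₀⁻¹, g₀ • q, hinv g₀ _ _ hq, ?_⟩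
  simp [mul_smul]

end Domain

end DiscreteMechanics
theorem mainTheorem10
    {EG : Type*} [NormedAddCommGroup EG] [NormedSpace ℝ EG] [FiniteDimensional ℝ EG]
    {G : Type*} [TopologicalSpace G] [T2Space G] [SecondCountableTopology G]
    [ChartedSpace EG G] [Group G] [LieGroup 𝓘(ℝ, EG) ∞ G]
    {E : Type*} [NormedAddCommGroup E] [NormedSpace ℝ E] [FiniteDimensional ℝ E]
    {Q : Type*} [TopologicalSpace Q] [T2Space Q] [SecondCountableTopology Q]
    [ChartedSpace E Q] [IsManifold 𝓘(ℝ, E) ∞ Q]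
    -- a smooth, free and proper left action of `G` on `Q`
    [MulAction G Q] [ContMDiffSMul 𝓘(ℝ, EG) 𝓘(ℝ, E) ∞ G Q] [ProperSMul G Q]
    (hfree : ∀ (g : G) (q : Q), g • q = q → g = 1)
    -- the discrete Lagrangian
    (L : Q × Q → ℝ) (hL : ContMDiff (𝓘(ℝ, E).prod 𝓘(ℝ, E)) 𝓘(ℝ, ℝ) ∞ L)
    (μ : GroupLieAlgebra 𝓘(ℝ, EG) G →L[ℝ] ℝ)
    -- the quotient manifold `Q/G_μ`: the orbit space with the quotient topology and the (unique)
    -- smooth structure for which the projection `π_μ : Q → Q/G_μ` is a submersion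
    {EB : Type*} [NormedAddCommGroup EB] [NormedSpace ℝ EB] [FiniteDimensional ℝ EB]
    [ChartedSpace EB (MulAction.orbitRel.Quotient (coadjointIsotropy μ) Q)]
    [IsManifold 𝓘(ℝ, EB) ∞
      (MulAction.orbitRel.Quotient (coadjointIsotropy μ) Q)]
    (hπ : Manifold.IsSubmersion 𝓘(ℝ, E) 𝓘(ℝ, EB) ∞
      (Quotient.mk _ : Q → MulAction.orbitRel.Quotient (coadjointIsotropy μ) Q))
    (hgood : IsMuGood E μ L)
    -- `γ(q)` is the element of `G_μ` with `J_μ(q, γ(q)q) = μ`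
    (γ : Q → coadjointIsotropy μ)
    (hγ : ∀ q : Q, (q, γ q • q) ∈ momentumLevel E μ L) :
    -- uniqueness, for every pair
    (∀ (q₀ q₁ : Q) (g g' : coadjointIsotropy μ),
      momentumMap EG E (coadjointIsotropy μ) L q₀ (g⁻¹ • q₁) =
        restrictMu μ →
      momentumMap EG E (coadjointIsotropy μ) L q₀ (g'⁻¹ • q₁) =
        restrictMu μ → g = g') ∧
    -- the domain is open, `G_μ × G_μ`-invariant and contains all pairs in a common orbit
    IsOpen (connectionDomain (coadjointIsotropy μ)
      (momentumLevel E μ L)) ∧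
    (∀ (g₀ g₁ : coadjointIsotropy μ) (q₀ q₁ : Q),
      (q₀, q₁) ∈ connectionDomain (coadjointIsotropy μ)
        (momentumLevel E μ L) →
      (g₀ • q₀, g₁ • q₁) ∈ connectionDomain
        (coadjointIsotropy μ) (momentumLevel E μ L)) ∧
    (∀ (q : Q) (g : coadjointIsotropy μ),
      (q, g • q) ∈ connectionDomain (coadjointIsotropy μ)
        (momentumLevel E μ L)) ∧
    -- existence and uniqueness on the domain, hence for all pairs if the domain is `Q × Q`
    (∀ q₀ q₁ : Q,
      (q₀, q₁) ∈ connectionDomain (coadjointIsotropy μ)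
        (momentumLevel E μ L) →
      ∃! g : coadjointIsotropy μ,
        momentumMap EG E (coadjointIsotropy μ) L
          q₀ (g⁻¹ • q₁) = restrictMu μ) ∧
    (connectionDomain (coadjointIsotropy μ)
        (momentumLevel E μ L) = Set.univ →
      ∀ q₀ q₁ : Q, ∃! g : coadjointIsotropy μ,
        momentumMap EG E (coadjointIsotropy μ) L
          q₀ (g⁻¹ • q₁) = restrictMu μ) ∧
    -- the level set is an affine discrete connection on `π_μ` with level `γ`
    IsAffineDiscreteConnection EG E EB (coadjointIsotropy μ) γ
      (momentumLevel E μ L) := by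
  have hlevel : ∀ p, p ∈ momentumLevel E μ L ↔
      momentumDefect (EG := EG) (coadjointIsotropy μ) μ L p = 0 :=
    fun p => momentumDefect_eq_zero_iff hL
  have hΦ : ∀ p ∈ momentumLevel E μ L, _ := fun p _ =>
    isLocalDiffeomorphAt_quotient_momentumDefect (EG := EG) hL hfree hπ hgood.subgroupRegular μ p
  have hf : ContMDiff (𝓘(ℝ, E).prod 𝓘(ℝ, E)) (𝓘(ℝ, E).prod 𝓘(ℝ, EB)) ∞
      (fun p : Q × Q =>
        (p.1, (Quotient.mk _ p.2 : MulAction.orbitRel.Quotient (coadjointIsotropy μ) Q))) :=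
    contMDiff_fst.prodMk (hπ.contMDiff.comp contMDiff_snd)
  have hinj : Set.InjOn (fun p : Q × Q =>
      (p.1, (Quotient.mk _ p.2 : MulAction.orbitRel.Quotient (coadjointIsotropy μ) Q)))
      (momentumLevel E μ L) := by
    rintro ⟨q₀, q₁⟩ hp ⟨q₀', q₁'⟩ hp' he
    obtain ⟨h1, h2⟩ := Prod.mk.inj he
    obtain rfl : q₀ = q₀' := h1
    obtain ⟨g, hg⟩ := Quotient.exact h2
    obtain rfl : g • q₁' = q₁ := hg
    rw [hgood.eq_one q₀ q₁' g hp' hp, one_smul]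
  have hinv : ∀ (h : coadjointIsotropy μ) (q₀ q₁ : Q), (q₀, q₁) ∈ momentumLevel E μ L →
      (h • q₀, h • q₁) ∈ momentumLevel E μ L :=
    fun h q₀ q₁ hp => smul_mem_momentumLevel hL hgood.symm h hp
  have huniq : ∀ (q₀ q₁ : Q) (g g' : coadjointIsotropy μ),
      momentumMap EG E (coadjointIsotropy μ) L q₀ (g⁻¹ • q₁) = restrictMu μ →
      momentumMap EG E (coadjointIsotropy μ) L q₀ (g'⁻¹ • q₁) = restrictMu μ → g = g' := by
    intro q₀ q₁ g g' h h'
    have h1 := hgood.eq_one q₀ (g⁻¹ • q₁) (g'⁻¹ * g) h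
      (by rwa [mul_smul, smul_inv_smul])
    exact (inv_mul_eq_one.1 h1).symm
  have hexu : ∀ q₀ q₁ : Q, (q₀, q₁) ∈ connectionDomain (coadjointIsotropy μ)
      (momentumLevel E μ L) → ∃! g : coadjointIsotropy μ,
        momentumMap EG E (coadjointIsotropy μ) L q₀ (g⁻¹ • q₁) = restrictMu μ := by
    rintro q₀ q₁ ⟨h, q, hq, he⟩
    obtain rfl : q₁ = h • q := he
    have h1 : momentumMap EG E (coadjointIsotropy μ) L q₀ (h⁻¹ • h • q) = restrictMu μ := by
      rw [inv_smul_smul]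
      exact hq
    exact ⟨h, h1, fun g hg => huniq _ _ _ _ hg h1⟩
  refine ⟨huniq, ?_, fun g₀ g₁ q₀ q₁ hp => smul_mem_connectionDomain hinv g₀ g₁ hp, ?_, hexu,
    fun huniv q₀ q₁ => hexu q₀ q₁ (huniv ▸ Set.mem_univ _), ?_, ?_, hγ, hinv, hinj, ?_⟩
  · have h1 := ((isOpenEmbedding_levelSet hlevel hΦ hinj).isOpen_range).preimage hf.continuous
    convert h1 using 1
    ext p
    rw [mem_connectionDomain_iff]
    exact ⟨fun ⟨p', hp', he⟩ => ⟨⟨p', hp'⟩, he⟩, fun ⟨p', he⟩ => ⟨p', p'.2, he⟩⟩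
  · exact fun q g => ⟨g * (γ q)⁻¹, γ q • q, hγ q, by simp [mul_smul]⟩
  · -- `q ↦ (q, γ(q)q)` is the lift to the level set of the smooth map `q ↦ (q, π(q))`
    intro q
    have h1 : ContMDiffAt 𝓘(ℝ, E) (𝓘(ℝ, E).prod 𝓘(ℝ, E)) ∞ (fun q : Q => (q, γ q • q)) q := by
      refine contMDiffAt_of_comp hlevel hΦ hinj hγ
        ((contMDiff_id.prodMk hπ.contMDiff).contMDiffAt.congr_of_eventuallyEq
          (Filter.Eventually.of_forall fun x => Prod.ext rfl (Quotient.sound ⟨γ x, rfl⟩)))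
    exact contMDiffAt_of_smul (E := E) hfree (a := id) contMDiffAt_id
      (contMDiffAt_snd.comp q h1)
  · intro h q
    have h1 : momentumMap EG E (coadjointIsotropy μ) L (h • q) ((h * γ q * h⁻¹) • h • q) =
        restrictMu μ := by
      have := hinv h _ _ (hγ q)
      rwa [← mul_smul, show h * γ q * h⁻¹ * h = h * γ q by group, mul_smul]
    exact (hgood.existsUnique_vertical (h • q)).unique (hγ (h • q)) h1
  · let A : (E × EB) ≃L[ℝ] EuclideanSpace ℝ (Fin (Module.finrank ℝ (E × EB))) := toEuclidean
    exact ⟨_, exists_chartedSpace_levelSet hlevel hΦ hinj A⟩
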